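/- **Conventions.** Graphs are finite, weighted and undirected, with arbitrary positive real edge weights; $d_G(u,v)\in[0,\infty]$ is the distance, and $d_G^{(t)}(u,v)$ is the minimum weight of a $u$–$v$ path with at most $t$ edges. In a union $G\cup H$ of weighted graphs on the same vertices, the lighter of two parallel edges counts. $\log$ is to base 2. A weighted graph $H$ on the vertices of $G$ in which every edge $\{u,v\}$ has weight at least $d_G(u,v)$ is a $(\beta,\epsilon)$-*hopset* of $G$ if $d_G(u,v)\le d^{(\beta)}_{G\cup H}(u,v)\le(1+\epsilon)d_G(u,v)$ for all $u,v$; it is a $(\beta,\epsilon,t)$-*hopset* if this holds for all pairs with $d_G(u,v)=d_G^{(t)}(u,v)$. **Construction with half-bunches.** Let $H'$ be a weighted graph on $V$, let $V=A_0\supseteq A_1\supseteq\dots\supseteq A_{k'+1}=\emptyset$, and let $\beta\ge 1$. Put $H_{-1}=\emptyset$. For $i=0,\dots,k'$ let $G_i=G\cup H'\cup H_{i-1}$ and $\hat d(u)=\min_{z\in A_{i+1}}d^{(8\beta)}_{G_i}(u,z)$ ($\infty$ if there is no such $z$), and for $u\in A_i\setminus A_{i+1}$ with $\hat d(u)<\infty$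 let the pivot $p(u)$ be any vertex of $A_{i+1}$ attaining $\hat d(u)$. Then $H_i$ is obtained from $H_{i-1}$ by adding, for each $u\in A_i\setminus A_{i+1}$, an edge $\{u,v\}$ of weight $d^{(4\beta)}_{G_i}(u,v)$ for all $v\in A_i\setminus\{u\}$ with $d^{(4\beta)}_{G_i}(u,v)<\hat d(u)/2$, and the edge $\{u,p(u)\}$ of weight $\hat d(u)$ if $\hat d(u)<\infty$. **Congested Clique.** The $n$ vertices are processors with names $0,\dots,n-1$; each knows $n$, its incident edges with their weights, and private fair coin flips. In every synchronous round each vertex sends one message to each vertex; local computation is free. For a constant $c$, a message consists of a word with $n^c$ possible values and at most $c$ real numbers; each of these numbers is a sum of at most $c$ numbers that the sender knows (weights of its incident edges, numbers received before) and is at most $n^c$ times the largest edge weight. An algorithm *computes a $(\beta,\epsilon)$-hopset of size at most $S$ in $T$ rounds with failure probability at most $q$* if on every weighted graph with $n$ vertices and for all coin flips, after $T$ rounds, either every vertex knows its incident edges, with their weights, of one $(\beta,\epsilon)$-hopset with at most $S$ edges, or all vertices report failure; and on every graph the latter has probability at most $q$. **Theorem.** (1) *One hop scale.* Let $G$ be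 a weighted graph with $n\ge 2$ vertices, $k'\ge 2$, $1\le\ell\le\lceil\log n\rceil$, $0<\epsilon<1/(5\log n)$, $0<\delta<1/(15k')$, $\beta=\lfloor(3/\delta)^{k'}\rfloor$, let $H'$ be a $(\beta,(1+\epsilon)^{\ell-1}-1,2^{\ell-1})$-hopset of $G$, and let $H_0,\dots,H_{k'}$ be constructed as above from any sets $A_i$ and any choice of the pivots. Then for all $x,y$ with $d_G(x,y)=d_G^{(2^\ell)}(x,y)$ and all $0\le i\le k'$, with $h=\lfloor(3/\delta)^i\rfloor$, at least one of the following holds: $d^{(h)}_{G\cup H_i}(x,y)\le(1+\epsilon)^{\ell-1}(1+12\delta i)\,d_G(x,y)$, or there is $z\in A_{i+1}$ with $d^{(h)}_{G\cup H_i}(x,z)\le 3\,d_G(x,y)$. (2) *All hop scales.* Let $G$ be a weighted graph with $n\ge2$ vertices, $k'\ge 2$, $0<\epsilon<1/(5\log n)$, $\beta=\lfloor(45k'/\epsilon)^{k'}\rfloor$. Let $H^{(0)}=\emptyset$, and for $1\le\ell\le\lceil\log n\rceil$ let $H^{(\ell)}$ be the graph $H_{k'}$ constructed as above from $H'=H^{(\ell-1)}$,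 with any sets $A_i$ and pivots (which may depend on $\ell$). Then $H^{(\ell)}$ is a $(\beta,(1+\epsilon)^\ell-1,2^\ell)$-hopset of $G$ for all $\ell\le\lceil\log n\rceil$, and $H^{(\lceil\log n\rceil)}$ is a $(\beta,(1+\epsilon)^{\lceil\log n\rceil}-1)$-hopset of $G$. (3) *Distributed algorithms.* There are absolute constants $c,C$, and for every $\gamma\in\mathbb N$ a constant $D$, such that the following holds for all integers $n,k\ge2$ and all reals $0<\rho<1$, $0<\epsilon<1/5$, with messages as above with the constant $c$. Let $S=C\,n^{1+1/(2^k-1)}$. (a) There is a randomized Congested Clique algorithm that computes a $(\beta,\epsilon)$-hopset of size at most $S$ with failure probability at most $n^{-\gamma}$ in at most $D\log^{D}n\cdot n^\rho\beta$ rounds, where $\beta\le\left(C\,\frac{(k+1/\rho)\log n}{\epsilon}\right)^{k+1/\rho+1}$. (b) For every integer $1\le t\le\log n$, there is such an algorithm with at most $D\log^{D}n\cdot n^\rho\beta\,2^t/t$ rounds and $\beta\le\left(C\,\frac{(k+1/\rho)\log n}{t\,\epsilon}\right)^{k+1/\rho}$. (c) If $\rho<1/2$, there is such an algorithm with at most $D\log^{D}n\cdot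 n^\rho\beta$ rounds and $\beta\le\left(C\,\frac{k+1/\rho}{\rho\,\epsilon}\right)^{k+2/\rho}$. -/

import Mathlib

open scoped ENNReal

/-! ### Weighted graphs, hop-bounded distances, hopsets -/

/-- A weighted undirected graph on the vertex set `V`: `len u v` is the weight of the edge `{u, v}`,
and `len u v = ⊤` says that `u` and `v` are not adjacent. -/
structure WGraph (V : Type*) where
  len : V → V → ℝ≥0∞
  len_comm : ∀ u v, len u v = len v u
  len_self : ∀ v, len v v = ⊤

namespace WGraph

variable {V : Type*}

/-- All edge weights are positive. -/
def Positive (G : WGraph V) : Prop := ∀ u v, 0 < G.len u v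

/-- The underlying simple graph. -/
def graph (G : WGraph V) : SimpleGraph V where
  Adj u v := G.len u v ≠ ⊤
  symm := ⟨fun u v h => by rw [G.len_comm]; exact h⟩
  loopless := ⟨fun v h => h (G.len_self v)⟩

/-- The number of edges. -/
noncomputable def size (G : WGraph V) : ℕ := G.graph.edgeSet.ncard

/-- The largest edge weight (`0` if there are no edges). -/
noncomputable def maxLen (G : WGraph V) : ℝ≥0∞ := ⨆ (u) (v) (_ : G.len u v ≠ ⊤), G.len u v

/-- The graph without edges. -/
instance : EmptyCollection (WGraph V) := ⟨⟨fun _ _ => ⊤, fun _ _ => rfl, fun _ => rfl⟩⟩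

/-- The union of two weighted graphs; of two parallel edges the lighter one counts. -/
noncomputable instance : Union (WGraph V) :=
  ⟨fun G H => ⟨fun u v => min (G.len u v) (H.len u v),
    fun u v => by rw [G.len_comm, H.len_comm], fun v => by rw [G.len_self, H.len_self, min_self]⟩⟩

/-- The total weight of a walk. -/
noncomputable def walkLen (G : WGraph V) {u v : V} (p : G.graph.Walk u v) : ℝ≥0∞ :=
  (p.darts.map fun d => G.len d.fst d.snd).sum

/-- The distance `d_G(u, v)` (`⊤` if `u` and `v` are in different components). -/
noncomputable def dist (G : WGraph V) (u v : V) : ℝ≥0∞ := ⨅ p : G.graph.Walk u v, G.walkLen p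

/-- The `t`-bounded distance `d_G^{(t)}(u, v)`: only paths with at most `t` edges count. -/
noncomputable def hopDist (G : WGraph V) (t : ℕ) (u v : V) : ℝ≥0∞ :=
  ⨅ (p : G.graph.Walk u v) (_ : p.length ≤ t), G.walkLen p

/-- `H` is a `(β, ε, t)`-hopset of `G`: only pairs with a shortest path of at most `t` edges have to
be approximated. -/
def IsHopsetUpTo (G H : WGraph V) (β : ℕ) (ε : ℝ) (t : ℕ) : Prop :=
  (∀ u v, G.dist u v ≤ H.len u v) ∧
    ∀ u v, G.dist u v = G.hopDist t u v →
      G.dist u v ≤ (G ∪ H).hopDist β u v ∧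
        (G ∪ H).hopDist β u v ≤ ENNReal.ofReal (1 + ε) * G.dist u v

/-- `H` is a `(β, ε)`-hopset of `G`. -/
def IsHopset (G H : WGraph V) (β : ℕ) (ε : ℝ) : Prop :=
  (∀ u v, G.dist u v ≤ H.len u v) ∧
    ∀ u v, G.dist u v ≤ (G ∪ H).hopDist β u v ∧
      (G ∪ H).hopDist β u v ≤ ENNReal.ofReal (1 + ε) * G.dist u v

/-! ### The construction with half-bunches -/

/-- The `t`-bounded distance from `u` to a set of vertices. -/
noncomputable def hopDistTo (G : WGraph V) (t : ℕ) (u : V) (S : Set V) : ℝ≥0∞ :=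
  ⨅ z ∈ S, G.hopDist t u z

/-- The half-bunch of `u` without its pivot, where `S = A_i`, `S' = A_{i+1}`: the vertices of `S`
closer to `u` (with `4β` hops) than half the distance (with `8β` hops) from `u` to `S'`. -/
def halfBunch (G : WGraph V) (β : ℕ) (S S' : Set V) (u : V) : Set V :=
  {v | v ∈ S ∧ G.hopDist (4 * β) u v < G.hopDistTo (8 * β) u S' / 2}

open Classical in
/-- The weight that the vertex `u` gives to the new edge `(u, v)`, and `⊤` if it does not create
that edge; `p u` is the pivot of `u`, which exists if `S'` is reached within `8β` hops. -/
noncomputable def bunchLen (G : WGraph V) (β : ℕ) (S S' : Set V) (p : V → V) (u v : V) : ℝ≥0∞ :=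
  if u ∈ S \ S' ∧ v ∈ G.halfBunch β S S' u then G.hopDist (4 * β) u v
  else if u ∈ S \ S' ∧ G.hopDistTo (8 * β) u S' < ⊤ ∧ v = p u then G.hopDist (8 * β) u v
  else ⊤

open Classical in
/-- The graph of the edges `(u, v)` with `u ∈ S \ S'` and `v` in the half-bunch of `u`. -/
noncomputable def bunchGraph (G : WGraph V) (β : ℕ) (S S' : Set V) (p : V → V) : WGraph V where
  len u v := if u = v then ⊤ else min (G.bunchLen β S S' p u v) (G.bunchLen β S S' p v u)
  len_comm u v := by simp only [eq_comm (a := u), min_comm]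
  len_self v := by simp

/-- One hop scale: `partialHopset G H' A p β m` is `H_{m-1}`, built on top of the hopset `H'` of the
previous scale with the vertex sets `A 0 ⊇ A 1 ⊇ …`. So `H_{-1}` has no edges, and `H_i` is
`H_{i-1}` with the half-bunch edges of `A_i \ A_{i+1}` in `G_i = G ∪ H' ∪ H_{i-1}`. -/
noncomputable def partialHopset (G H' : WGraph V) (A : ℕ → Set V) (p : ℕ → V → V) (β : ℕ) :
    ℕ → WGraph V
  | 0 => ∅
  | i + 1 => partialHopset G H' A p β i ∪
      (G ∪ H' ∪ partialHopset G H' A p β i).bunchGraph β (A i) (A (i + 1)) (p i)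

/-- `p i u` is a pivot of every `u ∈ A_i \ A_{i+1}` from which `A_{i+1}` is reached in `G_i` within
`8β` hops: a vertex of `A_{i+1}` closest to `u`. -/
def ArePivots (G H' : WGraph V) (A : ℕ → Set V) (p : ℕ → V → V) (β : ℕ) : Prop :=
  ∀ i, ∀ u ∈ A i \ A (i + 1),
    (G ∪ H' ∪ partialHopset G H' A p β i).hopDistTo (8 * β) u (A (i + 1)) < ⊤ →
      p i u ∈ A (i + 1) ∧
        (G ∪ H' ∪ partialHopset G H' A p β i).hopDist (8 * β) u (p i u) =
          (G ∪ H' ∪ partialHopset G H' A p β i).hopDistTo (8 * β) u (A (i + 1))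

/-- `V = A_0 ⊇ A_1 ⊇ … ⊇ A_{k'+1} = ∅`. -/
def IsHierarchy (A : ℕ → Set V) (k' : ℕ) : Prop :=
  A 0 = Set.univ ∧ (∀ i, A (i + 1) ⊆ A i) ∧ A (k' + 1) = ∅

/-- `H` is a hopset that the construction produces, with the indices `0, …, k'`, on top of `H'`. -/
def IsNextScale (G H' H : WGraph V) (k' β : ℕ) : Prop :=
  ∃ (A : ℕ → Set V) (p : ℕ → V → V), IsHierarchy A k' ∧ ArePivots G H' A p β ∧
    H = partialHopset G H' A p β (k' + 1)

end WGraph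

/-! ### The Congested Clique -/

/-- A message: a word of `O(log n)` bits, and at most `c` edge weights or distances
(`⊤` in a slot that is not used). -/
structure CliqueMsg (n c : ℕ) where
  word : Fin (n ^ c)
  val : Fin c → ℝ≥0∞

/-- A randomized algorithm for the Congested Clique on the vertices `0, …, n - 1`. At the start, a
vertex knows its name, the weights of the edges at it, and its own `coins` coin flips. In every
round it sends one message to each vertex and then receives one message from each vertex. Local
computation is free. `out` is the output: `none` for failure, or the weights of the output edges
at the vertex. -/
structure CliqueAlg (n c : ℕ) where
  State : Type
  coins : ℕ
  start : Fin n → (Fin n → ℝ≥0∞) → (Fin coins → Bool) → State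
  send : State → Fin n → CliqueMsg n c
  recv : State → (Fin n → CliqueMsg n c) → State
  out : State → Option (Fin n → ℝ≥0∞)

namespace CliqueAlg

variable {n c : ℕ}

/-- The outcomes of all coin flips of all vertices. -/
abbrev Seed (A : CliqueAlg n c) : Type := Fin n → Fin A.coins → Bool

/-- The states of the vertices after `r` rounds on the input graph `G`. -/
def run (A : CliqueAlg n c) (G : WGraph (Fin n)) (ω : A.Seed) : ℕ → Fin n → A.State
  | 0 => fun v => A.start v (G.len v) (ω v)
  | r + 1 => fun v => A.recv (A.run G ω r v) fun u => A.send (A.run G ω r u) v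

/-- The numbers that `v` knows before the round `r`: the weights of the edges at `v`, and the numbers
in the messages that `v` has received. -/
def known (A : CliqueAlg n c) (G : WGraph (Fin n)) (ω : A.Seed) (r : ℕ) (v : Fin n) : Set ℝ≥0∞ :=
  {x | (∃ u, x = G.len v u) ∨ ∃ s < r, ∃ u j, x = (A.send (A.run G ω s u) v).val j}

/-- The restriction on messages. Weights are arbitrary reals, so a single real number could hide an
unbounded amount of information. Therefore a number in a message has to be a sum of at most `c`
numbers that the sender knows, and it has to be at most `n ^ c` times the largest edge weight (so
that it has `O(log (n W))` bits if the weights are integers from `1` to `W`). -/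
def Bandwidth (A : CliqueAlg n c) : Prop :=
  ∀ (G : WGraph (Fin n)), G.Positive → ∀ (ω : A.Seed) (r : ℕ) (v u : Fin n) (j : Fin c),
    (A.send (A.run G ω r v) u).val j = ⊤ ∨
      ((A.send (A.run G ω r v) u).val j ≤ (n : ℝ≥0∞) ^ c * G.maxLen ∧
        ∃ s : Multiset ℝ≥0∞, s.card ≤ c ∧ (∀ x ∈ s, x ∈ A.known G ω r v) ∧
          s.sum = (A.send (A.run G ω r v) u).val j)

/-- After `T` rounds, the output is the weighted graph `H`: each vertex knows its edges of `H`. -/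
def Outputs (A : CliqueAlg n c) (G : WGraph (Fin n)) (ω : A.Seed) (T : ℕ) (H : WGraph (Fin n)) :
    Prop :=
  ∀ v, A.out (A.run G ω T v) = some (H.len v)

open Classical in
/-- `A` computes in `T` rounds a `(β, ε)`-hopset with at most `S` edges of every weighted graph on
`n` vertices. The output is never wrong: all vertices report failure otherwise, and this
happens with probability at most `q`. -/
def ComputesHopset (A : CliqueAlg n c) (T β : ℕ) (ε S q : ℝ) : Prop :=
  A.Bandwidth ∧ ∀ G : WGraph (Fin n), G.Positive →
    (∀ ω : A.Seed,
      (∃ H, A.Outputs G ω T H ∧ G.IsHopset H β ε ∧ (H.size : ℝ) ≤ S) ∨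
        ∀ v, A.out (A.run G ω T v) = none) ∧
    (1 - q) * (Fintype.card A.Seed : ℝ) ≤
      ((Finset.univ.filter fun ω : A.Seed => ∃ H, A.Outputs G ω T H).card : ℝ)

end CliqueAlg

/-! Stretch. Fix a hop scale, and let `Z` be a graph in which the previous hopset, applied to
consecutive pieces, replaces every shortest path of at most `L` edges by a path with few hops and
stretch `σ`. The induction over the vertex sets maintains the dichotomy `ApproxUnless`: a pair is
approximated with `h` hops and stretch `κ`, or some vertex of the next set lies within three times
its distance. To pass from `S` to `S'` (`ApproxUnless.next`), cut a shortest path of weight `r` into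
segments of weight at most `δ r` joined by single edges. If all segments are approximated, so is the
path. Otherwise the first bad segment seen from each end yields a vertex of `S` within `3 δ r` of
the path. `Z` joins these two vertices with few hops along the path, so `HasBunches` provides either
an edge between them, which bridges everything bad at an additive cost of at most `12 δ r σ`, or an
edge to a vertex of `S'`, which is the second alternative. The last set is empty, so that
alternative finally disappears. Only `HasBunches` is used of the new edges; hence one induction
serves both the half-bunches and the edges found by the algorithm.

Algorithm. By repeated relaxation every vertex maintains the list of its `K` nearest members of the
current set and broadcasts it; cutting the lists to `K` entries loses nothing that matters
(`IsLists.extend`). All vertices know all lists, so they can agree on the next set without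
communication or coins: a set that is small, meets every full list, and has small bunches on
average. It exists because a random sample works in expectation (`exists_sample`), and it yields
`HasBunches` (`IsLists.hasBunches`). Since the inverse sampling rates at most square from one set to
the next, `size + 32 * |A_i| * b_i` does not increase, which bounds the number of edges by `32 n
b_0`.

The algorithm is written as a broadcast program, verified by a weakest-precondition calculus and run
in the clique by `simulation`. With ratio `2 ^ t` between hop scales, `exists_hopset_alg` gives all
three bounds: `t = 1`, any `t`, and `2 ^ t` about `n ^ (ρ / 2)`. -/

namespace WGraph

variable {V : Type*}

/-! ### Walks and hop-bounded distances. -/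

theorem union_len (G H : WGraph V) (u v : V) : (G ∪ H).len u v = min (G.len u v) (H.len u v) := rfl

theorem empty_len (u v : V) : (∅ : WGraph V).len u v = ⊤ := rfl

theorem walkLen_nil (G : WGraph V) (u : V) :
    G.walkLen (SimpleGraph.Walk.nil : G.graph.Walk u u) = 0 := by simp [walkLen]

theorem walkLen_cons (G : WGraph V) {u v w : V} (h : G.graph.Adj u v) (p : G.graph.Walk v w) :
    G.walkLen (SimpleGraph.Walk.cons h p) = G.len u v + G.walkLen p := by simp [walkLen]

theorem walkLen_reverse (G : WGraph V) {u v : V} (p : G.graph.Walk u v) :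
    G.walkLen p.reverse = G.walkLen p := by
  unfold walkLen
  rw [SimpleGraph.Walk.darts_reverse, List.map_reverse, List.sum_reverse, List.map_map]
  congr 1
  apply List.map_congr_left
  intro d _
  exact G.len_comm _ _

theorem hopDist_le_walkLen (G : WGraph V) {t : ℕ} {u v : V} (p : G.graph.Walk u v)
    (h : p.length ≤ t) : G.hopDist t u v ≤ G.walkLen p := iInf₂_le p h

theorem dist_le_hopDist (G : WGraph V) (t : ℕ) (u v : V) : G.dist u v ≤ G.hopDist t u v :=
  le_iInf₂ fun p _ => iInf_le _ p

theorem le_dist_of_le_hopDist (G : WGraph V) {u v : V} {r : ℝ≥0∞}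
    (h : ∀ t, r ≤ G.hopDist t u v) : r ≤ G.dist u v :=
  le_iInf fun p => (h p.length).trans (G.hopDist_le_walkLen p le_rfl)

theorem hopDist_self (G : WGraph V) (t : ℕ) (u : V) : G.hopDist t u u = 0 :=
  le_antisymm ((G.hopDist_le_walkLen .nil (by simp)).trans (G.walkLen_nil u).le) zero_le

theorem hopDist_zero (G : WGraph V) {u v : V} (h : u ≠ v) : G.hopDist 0 u v = ⊤ := by
  refine iInf₂_eq_top.2 fun p hp => ?_
  cases p with
  | nil => exact absurd rfl h
  | cons _ _ => simp at hp

theorem hopDist_mono (G : WGraph V) {s t : ℕ} (h : s ≤ t) (u v : V) :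
    G.hopDist t u v ≤ G.hopDist s u v :=
  le_iInf₂ fun p hp => G.hopDist_le_walkLen p (hp.trans h)

theorem hopDist_comm (G : WGraph V) (t : ℕ) (u v : V) : G.hopDist t u v = G.hopDist t v u := by
  have key : ∀ u v, G.hopDist t u v ≤ G.hopDist t v u := fun u v =>
    le_iInf₂ fun p hp => (G.hopDist_le_walkLen p.reverse (by simpa using hp)).trans
      (G.walkLen_reverse p).le
  exact le_antisymm (key u v) (key v u)

theorem dist_comm (G : WGraph V) (u v : V) : G.dist u v = G.dist v u := by
  have key : ∀ u v, G.dist u v ≤ G.dist v u := fun u v =>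
    le_dist_of_le_hopDist G fun t => (G.dist_le_hopDist t u v).trans (G.hopDist_comm t u v).le
  exact le_antisymm (key u v) (key v u)

theorem hopDist_succ_le (G : WGraph V) (t : ℕ) (u v w : V) :
    G.hopDist (t + 1) u v ≤ G.len u w + G.hopDist t w v := by
  by_cases h : G.len u w = ⊤
  · simp [h]
  simp only [hopDist, ENNReal.add_iInf]
  refine le_iInf₂ fun p hp => ?_
  refine (iInf₂_le (SimpleGraph.Walk.cons (show G.graph.Adj u w from h) p)
    (by simpa using hp)).trans ?_
  rw [walkLen_cons]

theorem le_hopDist_succ (G : WGraph V) {t : ℕ} {u v : V} {r : ℝ≥0∞} (h0 : u = v → r = 0)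
    (h : ∀ w, r ≤ G.len u w + G.hopDist t w v) : r ≤ G.hopDist (t + 1) u v := by
  refine le_iInf₂ fun p hp => ?_
  cases p with
  | nil => simp [h0 rfl]
  | cons ha p =>
    rw [walkLen_cons]
    exact (h _).trans (by gcongr; exact G.hopDist_le_walkLen p (by simpa using hp))

theorem hopDist_succ (G : WGraph V) (t : ℕ) {u v : V} (h : u ≠ v) :
    G.hopDist (t + 1) u v = ⨅ w, G.len u w + G.hopDist t w v :=
  le_antisymm (le_iInf fun w => G.hopDist_succ_le t u v w)
    (G.le_hopDist_succ (fun e => absurd e h) fun w => iInf_le _ w)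

theorem hopDist_le_len (G : WGraph V) {t : ℕ} (ht : 1 ≤ t) (u v : V) :
    G.hopDist t u v ≤ G.len u v := by
  refine (G.hopDist_mono ht u v).trans ((G.hopDist_succ_le 0 u v v).trans ?_)
  simp [hopDist_self]

theorem dist_le_len (G : WGraph V) (u v : V) : G.dist u v ≤ G.len u v :=
  (G.dist_le_hopDist 1 u v).trans (G.hopDist_le_len le_rfl u v)

theorem dist_self (G : WGraph V) (u : V) : G.dist u u = 0 :=
  le_antisymm ((G.dist_le_hopDist 0 u u).trans (G.hopDist_self 0 u).le) zero_le

theorem hopDist_triangle (G : WGraph V) (s t : ℕ) (u v w : V) :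
    G.hopDist (s + t) u w ≤ G.hopDist s u v + G.hopDist t v w := by
  induction s generalizing u with
  | zero =>
    by_cases h : u = v
    · subst h; simp [hopDist_self]
    · simp [hopDist_zero G h]
  | succ s ih =>
    by_cases h : u = v
    · subst h; simp only [hopDist_self, zero_add]; exact G.hopDist_mono (by omega) _ _
    · rw [hopDist_succ G s h, ENNReal.iInf_add]
      refine le_iInf fun x => ?_
      rw [show s + 1 + t = (s + t) + 1 by omega]
      exact (G.hopDist_succ_le _ u w x).trans
        ((add_le_add le_rfl (ih x)).trans (add_assoc _ _ _).ge)

theorem dist_triangle (G : WGraph V) (u v w : V) : G.dist u w ≤ G.dist u v + G.dist v w := by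
  refine (le_iInf fun p => le_iInf fun q => ?_ :
    G.dist u w ≤ ⨅ (p : G.graph.Walk u v) (q : G.graph.Walk v w), G.walkLen p + G.walkLen q).trans
      (by simp only [dist, ENNReal.iInf_add, ENNReal.add_iInf]; exact iInf_comm.le)
  refine (G.dist_le_hopDist (p.length + q.length) u w).trans
    ((G.hopDist_triangle _ _ u v w).trans ?_)
  exact add_le_add (G.hopDist_le_walkLen p le_rfl) (G.hopDist_le_walkLen q le_rfl)

theorem hopDist_mono_len {G H : WGraph V} (h : ∀ u v, G.len u v ≤ H.len u v) (t : ℕ) (u v : V) :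
    G.hopDist t u v ≤ H.hopDist t u v := by
  induction t generalizing u with
  | zero =>
    by_cases e : u = v
    · subst e; simp [hopDist_self]
    · simp [hopDist_zero H e]
  | succ t ih =>
    by_cases e : u = v
    · subst e; simp [hopDist_self]
    · rw [hopDist_succ H t e, hopDist_succ G t e]
      exact iInf_mono fun w => add_le_add (h u w) (ih w)

/-- If no edge of `H` is shorter than the distance in `G`, then no walk is. -/
theorem dist_le_hopDist_of_dist_le_len {G H : WGraph V} (h : ∀ u v, G.dist u v ≤ H.len u v)
    (t : ℕ) (u v : V) : G.dist u v ≤ H.hopDist t u v := by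
  induction t generalizing u with
  | zero =>
    by_cases e : u = v
    · subst e; simp [dist_self]
    · simp [hopDist_zero H e]
  | succ t ih =>
    by_cases e : u = v
    · subst e; simp [dist_self]
    · rw [hopDist_succ H t e]
      exact le_iInf fun w => (G.dist_triangle u w v).trans (add_le_add (h u w) (ih w))

theorem dist_le_union_len {G H H' : WGraph V} (h : ∀ u v, G.dist u v ≤ H.len u v)
    (h' : ∀ u v, G.dist u v ≤ H'.len u v) (u v : V) : G.dist u v ≤ (H ∪ H').len u v :=
  le_min (h u v) (h' u v)

theorem exists_hopDist_succ_eq [Finite V] (G : WGraph V) (t : ℕ) {u v : V} (h : u ≠ v) :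
    ∃ w, G.hopDist (t + 1) u v = G.len u w + G.hopDist t w v := by
  have : Nonempty V := ⟨u⟩
  obtain ⟨w, hw⟩ := exists_eq_ciInf_of_finite (f := fun w => G.len u w + G.hopDist t w v)
  exact ⟨w, by rw [hopDist_succ G t h, ← hw]⟩

theorem hopDist_pos [Finite V] {G : WGraph V} (hG : G.Positive) (t : ℕ) {u v : V} (h : u ≠ v) :
    0 < G.hopDist t u v := by
  cases t with
  | zero => simp [hopDist_zero G h]
  | succ t =>
    obtain ⟨w, hw⟩ := G.exists_hopDist_succ_eq t h
    rw [hw]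
    exact (hG u w).trans_le le_self_add

theorem dist_eq_hopDist [Fintype V] (G : WGraph V) {t : ℕ} (ht : Fintype.card V ≤ t) (u v : V) :
    G.dist u v = G.hopDist t u v := by
  classical
  refine le_antisymm (G.dist_le_hopDist t u v) (le_iInf fun p => ?_)
  have h1 : p.bypass.length ≤ t :=
    ((p.bypass_isPath).length_lt.le).trans ht
  refine (G.hopDist_le_walkLen _ h1).trans ?_
  unfold walkLen
  exact List.Sublist.sum_le_sum ((p.darts_bypass_sublist_darts).map _) (fun _ _ => zero_le)

theorem len_le_maxLen (G : WGraph V) {u v : V} (h : G.len u v ≠ ⊤) : G.len u v ≤ G.maxLen :=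
  le_iSup_of_le u (le_iSup_of_le v (le_iSup_of_le h le_rfl))

theorem hopDist_le_maxLen [Finite V] (G : WGraph V) (t : ℕ) (u v : V) (h : G.hopDist t u v ≠ ⊤) :
    G.hopDist t u v ≤ t * G.maxLen := by
  induction t generalizing u with
  | zero =>
    by_cases e : u = v
    · subst e; simp [hopDist_self]
    · simp [hopDist_zero G e] at h
  | succ t ih =>
    by_cases e : u = v
    · subst e; simp [hopDist_self]
    · obtain ⟨w, hw⟩ := G.exists_hopDist_succ_eq t e
      rw [hw] at h ⊢
      rw [ENNReal.add_ne_top] at h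
      rw [Nat.cast_succ, add_mul, one_mul, add_comm]
      exact add_le_add (ih w h.2) (G.len_le_maxLen h.1)

theorem dist_le_maxLen [Fintype V] (G : WGraph V) (u v : V) (h : G.dist u v ≠ ⊤) :
    G.dist u v ≤ Fintype.card V * G.maxLen := by
  rw [G.dist_eq_hopDist le_rfl] at h ⊢
  exact G.hopDist_le_maxLen _ u v h

end WGraph

/-! ### Segments of shortest paths and the induction over the vertex sets. -/

namespace WGraph

variable {V : Type*}

/-- There is a `u`–`v` path with at most `t` edges and weight at most `r`. -/
def Reaches (G : WGraph V) (t : ℕ) (u v : V) (r : ℝ) : Prop := G.hopDist t u v ≤ ENNReal.ofReal r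

/-- The distance of `u` and `v` is `r`, and there is a shortest path with at most `t` edges. -/
structure Shortest (G : WGraph V) (t : ℕ) (u v : V) (r : ℝ) : Prop where
  nonneg : 0 ≤ r
  reaches : G.Reaches t u v r
  le_dist : ENNReal.ofReal r ≤ G.dist u v

theorem Reaches.mono {G : WGraph V} {s t : ℕ} {u v : V} {a b : ℝ} (h : G.Reaches s u v a)
    (hst : s ≤ t) (hab : a ≤ b) : G.Reaches t u v b :=
  (G.hopDist_mono hst u v).trans (h.trans (ENNReal.ofReal_le_ofReal hab))

theorem Reaches.mono_len {G H : WGraph V} {t : ℕ} {u v : V} {a : ℝ} (h : G.Reaches t u v a)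
    (hGH : ∀ u v, H.len u v ≤ G.len u v) : H.Reaches t u v a :=
  (hopDist_mono_len hGH t u v).trans h

theorem Reaches.symm {G : WGraph V} {t : ℕ} {u v : V} {a : ℝ} (h : G.Reaches t u v a) :
    G.Reaches t v u a := (G.hopDist_comm t v u).le.trans h

theorem Reaches.trans {G : WGraph V} {s t : ℕ} {u v w : V} {a b : ℝ} (h : G.Reaches s u v a)
    (h' : G.Reaches t v w b) (ha : 0 ≤ a) (hb : 0 ≤ b) : G.Reaches (s + t) u w (a + b) := by
  unfold Reaches
  rw [ENNReal.ofReal_add ha hb]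
  exact (G.hopDist_triangle s t u v w).trans (add_le_add h h')

theorem Reaches.refl (G : WGraph V) (t : ℕ) (u : V) {a : ℝ} : G.Reaches t u u a := by
  simp [Reaches, hopDist_self]

theorem reaches_of_len {G : WGraph V} {u v : V} {a : ℝ} (h : G.len u v ≤ ENNReal.ofReal a) :
    G.Reaches 1 u v a := (G.hopDist_le_len le_rfl u v).trans h

theorem Reaches.dist_le {G : WGraph V} {t : ℕ} {u v : V} {a : ℝ} (h : G.Reaches t u v a) :
    G.dist u v ≤ ENNReal.ofReal a := (G.dist_le_hopDist t u v).trans h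

theorem Shortest.symm {G : WGraph V} {t : ℕ} {u v : V} {r : ℝ} (h : G.Shortest t u v r) :
    G.Shortest t v u r := ⟨h.nonneg, h.reaches.symm, h.le_dist.trans (G.dist_comm u v).le⟩

theorem Shortest.mono {G : WGraph V} {s t : ℕ} {u v : V} {r : ℝ} (h : G.Shortest s u v r)
    (hst : s ≤ t) : G.Shortest t u v r := ⟨h.nonneg, h.reaches.mono hst le_rfl, h.le_dist⟩

theorem Shortest.dist_eq {G : WGraph V} {t : ℕ} {u v : V} {r : ℝ} (h : G.Shortest t u v r) :
    G.dist u v = ENNReal.ofReal r := le_antisymm h.reaches.dist_le h.le_dist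

theorem shortest_of_dist_eq {G : WGraph V} {t : ℕ} {u v : V} (h : G.dist u v = G.hopDist t u v)
    (hf : G.dist u v ≠ ⊤) : G.Shortest t u v (G.dist u v).toReal :=
  ⟨ENNReal.toReal_nonneg, by rw [Reaches, ENNReal.ofReal_toReal hf, h], by
    rw [ENNReal.ofReal_toReal hf]⟩

theorem ofReal_le_of_add_le {x : ℝ≥0∞} {a b : ℝ} (ha : 0 ≤ a) (hb : 0 ≤ b)
    (h : ENNReal.ofReal (a + b) ≤ x + ENNReal.ofReal b) : ENNReal.ofReal a ≤ x := by
  rw [ENNReal.ofReal_add ha hb] at h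
  exact (ENNReal.add_le_add_iff_right ENNReal.ofReal_ne_top).1 h

/-- Both parts of a shortest path are shortest paths. -/
theorem shortest_of_reaches {G : WGraph V} {s t : ℕ} {u v w : V} {a b : ℝ}
    (h : G.Reaches s u v a) (h' : G.Reaches t v w b) (ha : 0 ≤ a) (hb : 0 ≤ b)
    (hd : ENNReal.ofReal (a + b) ≤ G.dist u w) : G.Shortest s u v a ∧ G.Shortest t v w b := by
  refine ⟨⟨ha, h, ofReal_le_of_add_le ha hb ?_⟩, ⟨hb, h', ofReal_le_of_add_le hb ha ?_⟩⟩
  · exact hd.trans ((G.dist_triangle u v w).trans (add_le_add le_rfl h'.dist_le))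
  · rw [add_comm b a, add_comm (G.dist v w)]
    exact hd.trans ((G.dist_triangle u v w).trans (add_le_add h.dist_le le_rfl))

theorem Reaches.cons {G : WGraph V} {t : ℕ} {u w v : V} {a b : ℝ}
    (h : G.len u w ≤ ENNReal.ofReal a) (h' : G.Reaches t w v b) (ha : 0 ≤ a) (hb : 0 ≤ b) :
    G.Reaches (t + 1) u v (a + b) := by
  rw [add_comm t 1]; exact (reaches_of_len h).trans h' ha hb

/-- A path of weight more than `θ` has an edge `{u, w}` such that `u` is the last vertex at distance
at most `θ` from the first one. -/
theorem Shortest.exists_split [Finite V] {G : WGraph V} {t : ℕ} {x y : V} {r θ : ℝ}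
    (h : G.Shortest t x y r) (hθ : θ < r) (hθ0 : 0 ≤ θ) :
    ∃ (u w : V) (t₁ t₂ : ℕ) (a e b : ℝ), t₁ + 1 + t₂ ≤ t ∧ a + e + b = r ∧ a ≤ θ ∧ θ < a + e ∧
      0 ≤ e ∧ G.len u w ≤ ENNReal.ofReal e ∧ G.Shortest t₁ x u a ∧ G.Shortest t₂ w y b := by
  -- Walk along the path edge by edge: `a ≤ θ` is the weight already passed and `b` the rest.
  -- Reaching `y` would force `b = 0` and `r ≤ θ`.
  suffices H : ∀ (t₂ t₁ : ℕ) (u : V) (a b : ℝ), t₁ + t₂ ≤ t → a + b = r → a ≤ θ → 0 ≤ a → 0 ≤ b →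
      G.Reaches t₁ x u a → G.Reaches t₂ u y b → _ from
    H t 0 x 0 r (by omega) (zero_add r) hθ0 le_rfl h.nonneg (Reaches.refl _ _ _) h.reaches
  intro t₂
  induction t₂ with
  | zero =>
    intro t₁ u a b ht hab haθ ha hb hx hy
    have := (shortest_of_reaches hx hy ha hb (by rw [hab]; exact h.le_dist)).2
    have huy : u = y := by
      by_contra hne
      have := this.reaches
      rw [Reaches, hopDist_zero G hne, top_le_iff] at this
      exact ENNReal.ofReal_ne_top this
    subst huy
    have h0 := this.le_dist
    rw [dist_self] at h0
    have : b ≤ 0 := by simpa using h0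
    linarith
  | succ t₂ ih =>
    intro t₁ u a b ht hab haθ ha hb hx hy
    by_cases huy : u = y
    · subst huy
      have h0 := (shortest_of_reaches hx hy ha hb (by rw [hab]; exact h.le_dist)).2.le_dist
      rw [dist_self] at h0
      have : b ≤ 0 := by simpa using h0
      linarith
    · obtain ⟨w, hw⟩ := G.exists_hopDist_succ_eq t₂ huy
      have hy' : G.len u w + G.hopDist t₂ w y ≤ ENNReal.ofReal b := hw ▸ hy
      have hf1 : G.len u w ≠ ⊤ := ne_top_of_le_ne_top ENNReal.ofReal_ne_top (le_self_add.trans hy')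
      have hf2 : G.hopDist t₂ w y ≠ ⊤ :=
        ne_top_of_le_ne_top ENNReal.ofReal_ne_top (le_add_self.trans hy')
      set e := (G.len u w).toReal with he
      have he0 : 0 ≤ e := ENNReal.toReal_nonneg
      have heb : e + (G.hopDist t₂ w y).toReal ≤ b := by
        rw [he, ← ENNReal.toReal_add hf1 hf2]
        exact ENNReal.toReal_le_of_le_ofReal hb hy'
      have hlen : G.len u w ≤ ENNReal.ofReal e := (ENNReal.ofReal_toReal hf1).ge
      have hwy : G.Reaches t₂ w y (b - e) := by
        rw [Reaches, ← ENNReal.ofReal_toReal hf2]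
        exact ENNReal.ofReal_le_ofReal (by linarith)
      have hbe : 0 ≤ b - e := by
        have : 0 ≤ (G.hopDist t₂ w y).toReal := ENNReal.toReal_nonneg
        linarith
      by_cases hθ' : a + e ≤ θ
      · exact ih (t₁ + 1) w (a + e) (b - e) (by omega) (by linarith) hθ' (by linarith) hbe
          (hx.trans (reaches_of_len hlen) ha he0) hwy
      · refine ⟨u, w, t₁, t₂, a, e, b - e, by omega, by linarith, haθ, not_le.1 hθ', he0, hlen, ?_, ?_⟩
        · exact (shortest_of_reaches hx hy ha hb (by rw [hab]; exact h.le_dist)).1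
        · exact (shortest_of_reaches (hx.trans (reaches_of_len hlen) ha he0) hwy (by linarith) hbe
            (by convert h.le_dist using 2; linarith)).2

/-- A shortest path is cut into segments of weight at most `θ`, up to the first segment that `X` does
not approximate with `h` edges and stretch `κ`. -/
theorem Shortest.exists_prefix [Finite V] {G X : WGraph V} (hX : ∀ u v, X.len u v ≤ G.len u v)
    {θ κ : ℝ} (hθ : 0 < θ) (hκ : 1 ≤ κ) (h : ℕ) (t : ℕ) {x y : V} {r : ℝ}
    (hxy : G.Shortest t x y r) :
    (∃ s : ℕ, s * θ ≤ r + θ ∧ X.Reaches (s * (h + 1)) x y (κ * r)) ∨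
    ∃ (u v : V) (t₀ t₁ t₂ : ℕ) (r₀ r₁ r₂ : ℝ) (s : ℕ), t₀ + t₁ + t₂ ≤ t ∧ r₀ + r₁ + r₂ = r ∧
      G.Shortest t₀ x u r₀ ∧ G.Shortest t₁ u v r₁ ∧ G.Shortest t₂ v y r₂ ∧ r₁ ≤ θ ∧
      s * θ ≤ r₀ ∧ X.Reaches (s * (h + 1)) x u (κ * r₀) ∧ ¬ X.Reaches h u v (κ * r₁) := by
  induction t using Nat.strong_induction_on generalizing x r with
  | _ t ih =>
    have hr := hxy.nonneg
    by_cases hrθ : r ≤ θ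
    · by_cases hX1 : X.Reaches h x y (κ * r)
      -- The last segment may be arbitrarily short; the summand `θ` in `s * θ ≤ r + θ` pays for it.
      · exact .inl ⟨1, by push_cast; linarith, hX1.mono (by omega) le_rfl⟩
      · refine .inr ⟨x, y, 0, t, 0, 0, r, 0, 0, by omega, by ring, ?_, hxy, ?_, hrθ, by simp,
          Reaches.refl _ _ _, hX1⟩ <;>
        exact ⟨le_rfl, Reaches.refl _ _ _, by simp⟩
    · obtain ⟨u, w, t₁, t₂, a, e, b, ht, hsum, ha, hae, he, hlen, hxu, hwy⟩ :=
        hxy.exists_split (not_le.1 hrθ) hθ.le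
      have ha0 := hxu.nonneg
      have hb0 := hwy.nonneg
      have huy : G.Shortest (t₂ + 1) u y (e + b) :=
        (shortest_of_reaches hxu.reaches (Reaches.cons hlen hwy.reaches he hb0) ha0
          (by linarith) (by convert hxy.le_dist using 2; linarith)).2
      by_cases hX1 : X.Reaches h x u (κ * a)
      -- The edge that leaves the segment may itself weigh more than `θ`, so it is taken from `G` at
      -- the price of one hop. Segment and edge together weigh more than `θ`, which bounds the
      -- number of segments.
      · have hxw : X.Reaches (h + 1) x w (κ * (a + e)) := by
          rw [mul_add]
          refine hX1.trans (reaches_of_len ((hX u w).trans (hlen.trans ?_))) (by positivity)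
            (by positivity)
          exact ENNReal.ofReal_le_ofReal (by nlinarith)
        have hxw' : G.Shortest (t₁ + 1) x w (a + e) :=
          (shortest_of_reaches (hxu.reaches.trans (reaches_of_len hlen) ha0 he) hwy.reaches
            (by linarith) hb0 (by rw [hsum]; exact hxy.le_dist)).1
        rcases ih t₂ (by omega) hwy with ⟨s, hs, hr'⟩ |
          ⟨u', v', s₀, s₁, s₂, r₀, r₁, r₂, s, hst, hsr, h0, h1, h2, hr1, hsθ, hX2, hX3⟩
        · refine .inl ⟨s + 1, by push_cast; linarith, ?_⟩
          have := hxw.trans hr' (by positivity) (by positivity)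
          convert this using 1
          · ring
          · rw [← hsum]; ring
        · have hr0 := h0.nonneg
          refine .inr ⟨u', v', t₁ + 1 + s₀, s₁, s₂, a + e + r₀, r₁, r₂, s + 1, by omega, by linarith,
            ?_, h1, h2, hr1, by push_cast; linarith, ?_, hX3⟩
          · refine (shortest_of_reaches (hxw'.reaches.trans h0.reaches (by linarith) hr0)
              (h1.reaches.trans h2.reaches h1.nonneg h2.nonneg) (by linarith)
              (add_nonneg h1.nonneg h2.nonneg) ?_).1
            convert hxy.le_dist using 2; linarith
          · have := hxw.trans hX2 (by positivity) (by positivity)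
            convert this using 1
            · ring
            · ring
      · refine .inr ⟨x, u, 0, t₁, t₂ + 1, 0, a, e + b, 0, by omega, by linarith,
          ⟨le_rfl, Reaches.refl _ _ _, by simp⟩, hxu, huy, ha, by simp, Reaches.refl _ _ _, hX1⟩

/-- The pairs with a shortest path of at most `L` edges are approximated by `X` with `h` edges and
stretch `κ`, unless `S` is close to both ends. -/
def ApproxUnless (G X : WGraph V) (L h : ℕ) (κ : ℝ) (S : Set V) : Prop :=
  ∀ x y r, G.Shortest L x y r → X.Reaches h x y (κ * r) ∨ ∃ z ∈ S, X.Reaches h x z (3 * r)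

/-- In `H`, every vertex `u ∈ S \ S'` has an edge to `v ∈ S`, or else an edge to a vertex of `S'` that
is at most twice as far away. Distances count `E` edges of `Z`, and those above `M` are ignored. -/
def HasBunches (Z H : WGraph V) (E : ℕ) (M : ℝ≥0∞) (S S' : Set V) : Prop :=
  ∀ u ∈ S \ S', ∀ v ∈ S, u ≠ v → ∀ d : ℝ, Z.Reaches E u v d → ENNReal.ofReal d ≤ M →
    H.len u v ≤ ENNReal.ofReal d ∨ ∃ z ∈ S', H.len u z ≤ ENNReal.ofReal (2 * d)

/-- All vertices belong to the first set, so the bunch of `x` decides at once. A direct edge has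
stretch `σ`; otherwise the edge to `S'` weighs at most `2 σ r ≤ 3 r`. -/
theorem approxUnless_first {G Z H : WGraph V} {L E b h : ℕ} {σ : ℝ} {M : ℝ≥0∞} {S' : Set V}
    (hσ' : σ ≤ 5 / 4) (hZ : ∀ x y r, G.Shortest L x y r → Z.Reaches b x y (σ * r))
    (hM : ∀ x y r, G.Shortest L x y r → ENNReal.ofReal (3 * r) ≤ M)
    (hH : HasBunches Z H E M Set.univ S') (hE : b ≤ E) (hh : 1 ≤ h) :
    ApproxUnless G (G ∪ H) L h σ S' := by
  intro x y r hxy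
  have hr := hxy.nonneg
  by_cases hx : x ∈ S'
  · exact .inr ⟨x, hx, Reaches.refl _ _ _⟩
  by_cases hne : x = y
  · subst hne; exact .inl (Reaches.refl _ _ _)
  have hlen : ∀ u v, (G ∪ H).len u v ≤ H.len u v := fun u v => min_le_right _ _
  rcases hH x ⟨trivial, hx⟩ y trivial hne (σ * r) ((hZ x y r hxy).mono hE le_rfl)
    ((ENNReal.ofReal_le_ofReal (by nlinarith)).trans (hM x y r hxy)) with h1 | ⟨z, hz, h1⟩
  · exact .inl ((reaches_of_len ((hlen _ _).trans h1)).mono hh le_rfl)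
  · exact .inr ⟨z, hz, (reaches_of_len ((hlen _ _).trans h1)).mono hh (by nlinarith)⟩

/-- Let `u` and `w` be the vertices near the two bad segments and `z`, `z'` the vertices of `S` near
them. Two side trips of weight at most `3 δ r` are walked, and two more are part of the weight of
the edge `z z'`: this is the `12 δ`. If an edge leads to `S'` instead, its weight is at most `2 (6 δ
r + σ (r₁ + r₃))`; with `κ, 2 σ ≤ 5 / 2` and `15 δ ≤ 1 / 2` the total from `x` is at most `3 r`. -/
theorem ApproxUnless.next [Finite V] {G H H₂ Z : WGraph V} (hG : G.Positive) {L E b h h' : ℕ}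
    {σ κ δ : ℝ} {M : ℝ≥0∞} {S S' : Set V} (hσ : 1 ≤ σ) (hσ' : σ ≤ 5 / 4) (hκ : 1 ≤ κ)
    (hσκ : σ ≤ κ) (hκ' : κ ≤ 2 * σ) (hδ : 0 < δ) (hδ' : δ ≤ 1 / 30)
    (hGH : ApproxUnless G (G ∪ H) L h κ S)
    (hZ : ∀ x y r, G.Shortest L x y r → Z.Reaches b x y (σ * r))
    (hZH : ∀ u v, Z.len u v ≤ (G ∪ H).len u v) (hH : ∀ u v, H₂.len u v ≤ H.len u v)
    (hM : ∀ x y r, G.Shortest L x y r → ENNReal.ofReal (3 * r) ≤ M)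
    (hB : HasBunches Z H₂ E M S S') (hE : b + 2 * h ≤ E) (h1 : 1 ≤ h)
    (hh : ∀ m : ℕ, (m : ℝ) ≤ 3 / δ * h → m ≤ h') :
    ApproxUnless G (G ∪ H₂) L h' (κ + 12 * δ * σ) S' := by
  intro x y r hxy
  by_cases hne : x = y
  · subst hne; exact .inl (Reaches.refl _ _ _)
  have hr : 0 < r := by
    refine lt_of_le_of_ne hxy.nonneg fun h0 => ?_
    have h2 := hxy.reaches
    rw [Reaches, ← h0, ENNReal.ofReal_zero] at h2
    exact (hopDist_pos hG L hne).not_ge h2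
  have hθ : 0 < δ * r := by positivity
  have hXY : ∀ u v, (G ∪ H₂).len u v ≤ (G ∪ H).len u v := fun u v => min_le_min le_rfl (hH u v)
  have hYH : ∀ u v, (G ∪ H₂).len u v ≤ H₂.len u v := fun u v => min_le_right _ _
  have hGX : ∀ u v, (G ∪ H).len u v ≤ G.len u v := fun u v => min_le_left _ _
  have hh1 : (1 : ℝ) ≤ h := by exact_mod_cast h1
  -- As `s ≤ 1 / δ + 1`, `h ≥ 1` and `1 / δ ≥ 30`, the count `s (h + 1) + 2 h + 1` is at most `3 h /
  -- δ`. The `2 h + 1` pays for both side trips and the new edge.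
  have hops : ∀ m s : ℕ, m ≤ s * (h + 1) + 2 * h + 1 → s * (δ * r) ≤ r + δ * r → m ≤ h' := by
    intro m s hm hs
    apply hh
    have hs' : (s : ℝ) ≤ 1 / δ + 1 := by
      rw [div_add_one hδ.ne', le_div_iff₀ hδ]
      nlinarith
    have hm' : (m : ℝ) ≤ s * (h + 1) + 2 * h + 1 := by exact_mod_cast hm
    have hd : 30 ≤ 1 / δ := by rw [le_div_iff₀ hδ]; linarith
    have : 3 / δ = 3 * (1 / δ) := by ring
    rw [this]
    set q := 1 / δ
    have : (s : ℝ) * (h + 1) ≤ (q + 1) * (h + 1) := by gcongr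
    nlinarith
  have hδr : δ * r ≤ r / 30 := by nlinarith
  rcases hxy.exists_prefix hGX hθ hκ h with ⟨s, hs, hX⟩ |
    ⟨u, v, t₀, t₁, t₂, r₀, r₁, r₂, s, ht, hsum, hxu, huv, hvy, hr1, hs, hX, hfail⟩
  · refine .inl ((hX.mono_len hXY).mono (hops _ s (by omega) hs) ?_)
    have : 0 ≤ 12 * δ * σ := by positivity
    nlinarith
  have hr0 := hxu.nonneg
  have hr1' := huv.nonneg
  have hr2 := hvy.nonneg
  obtain ⟨z, hz, hzX⟩ := (hGH u v r₁ (huv.mono (by omega))).resolve_left hfail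
  have hxz : (G ∪ H).Reaches (s * (h + 1) + h) x z (κ * r₀ + 3 * r₁) :=
    hX.trans hzX (by positivity) (by positivity)
  -- the last bad vertex `w`, its pivot `z'`, and the part of the path between `v` and `w`
  obtain ⟨w, z', t₃, t₄, s', r₃, r₄, hwy, hz', ht3, hr3, hr4, hs', hvw, hwz', hyw, hsum'⟩ :
      ∃ (w z' : V) (t₃ t₄ s' : ℕ) (r₃ r₄ : ℝ), G.Shortest t₄ w y r₄ ∧ z' ∈ S ∧ t₁ + t₃ ≤ L ∧ 0 ≤ r₃ ∧ 0 ≤ r₄ ∧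
        s' * (δ * r) ≤ r₄ + δ * r ∧ G.Shortest t₃ v w r₃ ∧
        (G ∪ H).Reaches h w z' (3 * (δ * r)) ∧
        (G ∪ H).Reaches (s' * (h + 1)) y w (κ * r₄) ∧ r₃ + r₄ = r₂ := by
    -- Scan the rest of the path backwards from `y`. If nothing bad is found, the segment between
    -- `u` and `v`, read from `v`, serves as the last bad one, and `w = v`.
    rcases hvy.symm.exists_prefix hGX hθ hκ h with ⟨s', hs', hX'⟩ |
      ⟨w, w', p₀, p₁, p₂, q₀, q₁, q₂, s', hp, hq, hyw, hww', hw'v, hq1, hs', hX', hfail'⟩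
    · obtain ⟨z', hz', hzX'⟩ := (hGH v u r₁ (huv.symm.mono (by omega))).resolve_left
        fun h => hfail h.symm
      exact ⟨v, z', 0, t₂, s', 0, r₂, hvy, hz', by omega, le_rfl, hr2, hs',
        ⟨le_rfl, Reaches.refl _ _ _, by simp⟩, hzX'.mono le_rfl (by linarith), hX', zero_add _⟩
    · obtain ⟨z', hz', hzX'⟩ := (hGH w w' q₁ (hww'.mono (by omega))).resolve_left hfail'
      have e0 := hyw.nonneg
      have e1 := hww'.nonneg
      have e2 := hw'v.nonneg
      refine ⟨w, z', p₁ + p₂, p₀, s', q₁ + q₂, q₀, hyw.symm, hz', by omega, by linarith, e0, by linarith, ?_,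
        hzX'.mono le_rfl (by linarith), hX', by linarith⟩
      refine Shortest.symm (shortest_of_reaches hyw.reaches (hww'.reaches.trans hw'v.reaches e1 e2)
        e0 (by linarith) ?_).2
      convert hvy.symm.le_dist using 2; linarith
  have huw : G.Shortest (t₁ + t₃) u w (r₁ + r₃) := by
    refine (shortest_of_reaches hxu.reaches (huv.reaches.trans hvw.reaches hr1' hr3) hr0
      (by linarith) ?_).2
    refine (shortest_of_reaches (hxu.reaches.trans (huv.reaches.trans hvw.reaches hr1' hr3) hr0
      (by linarith)) hwy.reaches (by linarith) hr4 ?_).1.le_dist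
    convert hxy.le_dist using 2; linarith
  have hδσ : δ * r ≤ δ * r * σ := by nlinarith
  have hzz : Z.Reaches E z z' (3 * (δ * r) + σ * (r₁ + r₃) + 3 * (δ * r)) := by
    have e1 : Z.Reaches h z u (3 * (δ * r)) :=
      (hzX.symm.mono_len hZH).mono le_rfl (by linarith)
    exact ((e1.trans (hZ u w _ (huw.mono ht3)) (by positivity) (by positivity)).trans
      (hwz'.mono_len hZH) (by positivity) (by positivity)).mono (by omega) le_rfl
  have hσ0 : σ * (r₁ + r₃) ≤ 5 / 4 * (r₁ + r₃) := by gcongr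
  have hκ0 : κ * r₀ ≤ 5 / 2 * r₀ := by gcongr; linarith
  -- Vertices of `S'` have no bunches at this level, but such a `z` is already the required witness.
  by_cases hzS : z ∈ S'
  · exact .inr ⟨z, hzS, (hxz.mono_len hXY).mono (hops _ s (by omega) (by nlinarith)) (by nlinarith)⟩
  have hedge : (G ∪ H₂).Reaches 1 z z' (3 * (δ * r) + σ * (r₁ + r₃) + 3 * (δ * r)) ∨
      ∃ q ∈ S', (G ∪ H₂).Reaches 1 z q (2 * (3 * (δ * r) + σ * (r₁ + r₃) + 3 * (δ * r))) := by
    by_cases hzz' : z = z'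
    · subst hzz'; exact .inl (Reaches.refl _ _ _)
    rcases hB z ⟨hz, hzS⟩ z' hz' hzz' _ hzz ((ENNReal.ofReal_le_ofReal (by linarith)).trans
      (hM x y r hxy)) with h2 | ⟨q, hq, h2⟩
    · exact .inl (reaches_of_len ((hYH _ _).trans h2))
    · exact .inr ⟨q, hq, reaches_of_len ((hYH _ _).trans h2)⟩
  rcases hedge with h2 | ⟨q, hq, h2⟩
  · left
    have h3 := ((hxz.mono_len hXY).trans h2 (by positivity) (by positivity)).trans
      ((hwz'.symm.mono_len hXY).trans (hyw.symm.mono_len hXY) (by positivity) (by positivity))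
      (by positivity) (by positivity)
    refine h3.mono (hops _ (s + s') (by ring_nf; omega) (by push_cast; nlinarith)) ?_
    have e1 : σ * (r₁ + r₃) ≤ κ * (r₁ + r₃) := by gcongr
    have e2 : κ * r = κ * r₀ + κ * (r₁ + r₃) + κ * r₄ := by rw [← hsum, ← hsum']; ring
    have e3 : (κ + 12 * δ * σ) * r = κ * r + 12 * (δ * r * σ) := by ring
    rw [e3, e2]
    linarith
  · right
    have h3 := (hxz.mono_len hXY).trans h2 (by positivity) (by positivity)
    exact ⟨q, hq, h3.mono (hops _ s (by omega) (by nlinarith)) (by linarith)⟩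
end WGraph

/-! ### From the dichotomy to hopsets. -/

namespace WGraph

variable {V : Type*}

theorem exists_hopDist_add_le [Finite V] (G : WGraph V) (s t : ℕ) {x y : V}
    (h : G.hopDist (s + t) x y ≠ ⊤) :
    ∃ u, G.hopDist s x u + G.hopDist t u y ≤ G.hopDist (s + t) x y := by
  induction s generalizing x with
  | zero => exact ⟨x, by simp [hopDist_self]⟩
  | succ s ih =>
    by_cases hxy : x = y
    · subst hxy; exact ⟨x, by simp [hopDist_self]⟩
    · rw [show s + 1 + t = (s + t) + 1 by omega] at h ⊢
      obtain ⟨w, hw⟩ := G.exists_hopDist_succ_eq (s + t) hxy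
      rw [hw] at h ⊢
      obtain ⟨u, hu⟩ := ih (ENNReal.add_ne_top.1 h).2
      refine ⟨u, le_trans ?_ (add_le_add le_rfl hu)⟩
      rw [← add_assoc]
      exact add_le_add (G.hopDist_succ_le _ _ _ _) le_rfl

theorem Shortest.exists_add [Finite V] {G : WGraph V} {s t : ℕ} {x y : V} {r : ℝ}
    (h : G.Shortest (s + t) x y r) :
    ∃ u a b, a + b = r ∧ G.Shortest s x u a ∧ G.Shortest t u y b := by
  obtain ⟨u, hu⟩ := G.exists_hopDist_add_le s t (ne_top_of_le_ne_top ENNReal.ofReal_ne_top h.reaches)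
  have hu' := hu.trans h.reaches
  have hf1 := ne_top_of_le_ne_top ENNReal.ofReal_ne_top (le_self_add.trans hu')
  have hf2 := ne_top_of_le_ne_top ENNReal.ofReal_ne_top (le_add_self.trans hu')
  have hr : (G.hopDist s x u).toReal + (G.hopDist t u y).toReal ≤ r := by
    rw [← ENNReal.toReal_add hf1 hf2]
    exact ENNReal.toReal_le_of_le_ofReal h.nonneg hu'
  have h1 : 0 ≤ (G.hopDist s x u).toReal := ENNReal.toReal_nonneg
  have h2 : 0 ≤ (G.hopDist t u y).toReal := ENNReal.toReal_nonneg
  have e1 : G.Reaches s x u (G.hopDist s x u).toReal := (ENNReal.ofReal_toReal hf1).ge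
  have e2 : G.Reaches t u y (r - (G.hopDist s x u).toReal) := by
    rw [Reaches, ← ENNReal.ofReal_toReal hf2]
    exact ENNReal.ofReal_le_ofReal (by linarith)
  have := shortest_of_reaches e1 e2 h1 (by linarith) (by convert h.le_dist using 2; linarith)
  exact ⟨u, _, _, by linarith, this.1, this.2⟩

/-- Pieces of a shortest path are shortest, so the hops multiply while the stretch does not
accumulate. -/
theorem Shortest.reaches_mul [Finite V] {G Z : WGraph V} {L b : ℕ} {σ : ℝ} (hσ : 0 ≤ σ)
    (hZ : ∀ x y r, G.Shortest L x y r → Z.Reaches b x y (σ * r)) (m : ℕ) {x y : V} {r : ℝ}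
    (h : G.Shortest (m * L) x y r) : Z.Reaches (m * b) x y (σ * r) := by
  induction m generalizing x r with
  | zero =>
    rw [zero_mul] at h
    by_cases hxy : x = y
    · subst hxy; exact Reaches.refl _ _ _
    · have := h.reaches
      rw [Reaches, hopDist_zero G hxy, top_le_iff] at this
      exact absurd this ENNReal.ofReal_ne_top
  | succ m ih =>
    rw [Nat.succ_mul, add_comm] at h
    obtain ⟨u, a, c, hac, h1, h2⟩ := h.exists_add
    have := (hZ _ _ _ h1).trans (ih h2) (mul_nonneg hσ h1.nonneg) (mul_nonneg hσ h2.nonneg)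
    rw [← hac, mul_add, Nat.succ_mul, add_comm (m * b)]
    exact this

theorem IsHopsetUpTo.reaches {G H : WGraph V} {β t : ℕ} {σ : ℝ} (h : G.IsHopsetUpTo H β (σ - 1) t)
    (hσ : 0 ≤ σ) {x y : V} {r : ℝ} (hxy : G.Shortest t x y r) :
    (G ∪ H).Reaches β x y (σ * r) := by
  have := (h.2 x y (le_antisymm (G.dist_le_hopDist t x y) (le_trans hxy.reaches hxy.le_dist))).2
  rw [hxy.dist_eq, ← ENNReal.ofReal_mul (by linarith), add_sub_cancel] at this
  exact this

theorem ApproxUnless.of_dist_eq {G X : WGraph V} {L h : ℕ} {κ : ℝ} {S : Set V}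
    (hX : ApproxUnless G X L h κ S) (hκ : 0 < κ) {x y : V} (hxy : G.dist x y = G.hopDist L x y) :
    X.hopDist h x y ≤ ENNReal.ofReal κ * G.dist x y ∨
      ∃ z ∈ S, X.hopDist h x z ≤ 3 * G.dist x y := by
  by_cases hf : G.dist x y = ⊤
  · left
    rw [hf, ENNReal.mul_top (by simpa using hκ)]
    exact le_top
  · have hr : G.dist x y = ENNReal.ofReal (G.dist x y).toReal := (ENNReal.ofReal_toReal hf).symm
    rcases hX x y _ (shortest_of_dist_eq hxy hf) with h1 | ⟨z, hz, h1⟩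
    · left; rw [hr, ← ENNReal.ofReal_mul hκ.le]; exact h1
    · refine .inr ⟨z, hz, ?_⟩
      rw [hr, show (3 : ℝ≥0∞) = ENNReal.ofReal 3 by simp, ← ENNReal.ofReal_mul (by norm_num)]
      exact h1

theorem ApproxUnless.isHopsetUpTo {G H : WGraph V} {L h : ℕ} {κ ε : ℝ}
    (hX : ApproxUnless G (G ∪ H) L h κ ∅) (hκ : 0 < κ) (hε : κ ≤ 1 + ε)
    (hH : ∀ u v, G.dist u v ≤ H.len u v) : G.IsHopsetUpTo H h ε L := by
  refine ⟨hH, fun u v huv => ⟨dist_le_hopDist_of_dist_le_len (G.dist_le_union_len G.dist_le_len hH)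
    h u v, ?_⟩⟩
  rcases hX.of_dist_eq hκ huv with h1 | ⟨z, hz, _⟩
  · exact h1.trans (by gcongr)
  · exact hz.elim

theorem IsHopsetUpTo.isHopset [Fintype V] {G H : WGraph V} {β t : ℕ} {ε : ℝ}
    (h : G.IsHopsetUpTo H β ε t) (ht : Fintype.card V ≤ t) : G.IsHopset H β ε :=
  ⟨h.1, fun u v => h.2 u v (G.dist_eq_hopDist ht u v)⟩

theorem isHopsetUpTo_empty (G : WGraph V) {β : ℕ} (hβ : 1 ≤ β) : G.IsHopsetUpTo ∅ β (1 - 1) 1 := by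
  refine ⟨fun u v => le_top, fun u v huv => ?_⟩
  have h : ∀ u v, (G ∪ ∅).len u v = G.len u v := fun u v => by
    rw [union_len, empty_len, min_eq_left le_top]
  refine ⟨dist_le_hopDist_of_dist_le_len (fun u v => (G.dist_le_len u v).trans (h u v).ge) β u v, ?_⟩
  have h2 := (hopDist_mono_len (fun u v => (h u v).le) β u v).trans (G.hopDist_mono hβ u v)
  simpa [huv] using h2

/-- One step of the induction over the vertex sets, with the parameters of the construction. -/
theorem ApproxUnless.next_level [Finite V] {G H H₂ Z : WGraph V} (hG : G.Positive)
    {L E b i k : ℕ} {σ δ : ℝ} {M : ℝ≥0∞} {S S' : Set V} (hσ : 1 ≤ σ) (hσ' : σ ≤ 5 / 4)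
    (hδ : 0 < δ) (hδ' : δ < 1 / (15 * k)) (hk : 2 ≤ k) (hi : i < k)
    (hGH : ApproxUnless G (G ∪ H) L ⌊(3 / δ) ^ i⌋₊ (σ * (1 + 12 * δ * i)) S)
    (hZ : ∀ x y r, G.Shortest L x y r → Z.Reaches b x y (σ * r))
    (hZH : ∀ u v, Z.len u v ≤ (G ∪ H).len u v) (hH : ∀ u v, H₂.len u v ≤ H.len u v)
    (hM : ∀ x y r, G.Shortest L x y r → ENNReal.ofReal (3 * r) ≤ M)
    (hB : HasBunches Z H₂ E M S S') (hE : b + 2 * ⌊(3 / δ) ^ i⌋₊ ≤ E) :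
    ApproxUnless G (G ∪ H₂) L ⌊(3 / δ) ^ (i + 1)⌋₊ (σ * (1 + 12 * δ * ((i + 1 : ℕ) : ℝ))) S' := by
  have hk' : (2 : ℝ) ≤ k := by exact_mod_cast hk
  have hik : (i : ℝ) ≤ k := by exact_mod_cast hi.le
  have hδk : δ * (15 * k) < 1 := by rwa [lt_div_iff₀ (by positivity)] at hδ'
  have hδ30 : δ ≤ 1 / 30 := by nlinarith
  have h3 : 1 ≤ 3 / δ := by rw [le_div_iff₀ hδ]; linarith
  have hp : 1 ≤ (3 / δ) ^ i := one_le_pow₀ h3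
  -- From `δ < 1 / (15 k)` and `i ≤ k`; it keeps the stretch of the level at most `2 σ`.
  have h12 : 12 * δ * i ≤ 1 := by nlinarith
  have h12' : 0 ≤ 12 * δ * i := by positivity
  have := hGH.next hG hσ hσ' (by nlinarith) (by nlinarith) (by nlinarith) hδ hδ30 hZ hZH hH hM hB hE
    (Nat.le_floor (by simpa using hp)) (h' := ⌊(3 / δ) ^ (i + 1)⌋₊) (fun m hm => Nat.le_floor ?_)
  · convert this using 1
    push_cast; ring
  · refine hm.trans ?_
    rw [pow_succ, mul_comm]
    gcongr
    exact Nat.floor_le (by positivity)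

/-- `exp (1 / 5) ≤ 5 / 4` because `exp (-1 / 5) ≥ 1 - 1 / 5`. -/
theorem one_add_pow_le {ε : ℝ} (hε : 0 ≤ ε) {m : ℕ} (hm : m * ε ≤ 1 / 5) : (1 + ε) ^ m ≤ 5 / 4 := by
  have h1 : (1 + ε) ^ m ≤ Real.exp (1 / 5) := by
    calc (1 + ε) ^ m ≤ Real.exp ε ^ m := by
          gcongr; linarith [Real.add_one_le_exp ε]
      _ = Real.exp (m * ε) := (Real.exp_nat_mul _ _).symm
      _ ≤ _ := Real.exp_le_exp.2 hm
  have h2 : (4 / 5 : ℝ) ≤ Real.exp (-(1 / 5)) := by linarith [Real.add_one_le_exp (-(1 / 5) : ℝ)]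
  rw [Real.exp_neg] at h2
  refine h1.trans ?_
  rw [le_inv_comm₀ (by norm_num) (Real.exp_pos _)] at h2
  linarith

/-! ### The construction with half-bunches -/

theorem hopDist_le_bunchLen (Z : WGraph V) (β : ℕ) (S S' : Set V) (p : V → V) (u v : V) :
    Z.hopDist (8 * β) u v ≤ Z.bunchLen β S S' p u v := by
  unfold bunchLen
  split_ifs
  · exact Z.hopDist_mono (by omega) u v
  · exact le_rfl
  · exact le_top

theorem dist_le_bunchGraph_len {G Z : WGraph V} (h : ∀ u v, G.dist u v ≤ Z.len u v) (β : ℕ)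
    (S S' : Set V) (p : V → V) (u v : V) : G.dist u v ≤ (Z.bunchGraph β S S' p).len u v := by
  have h1 : ∀ u v, G.dist u v ≤ Z.bunchLen β S S' p u v := fun u v =>
    (dist_le_hopDist_of_dist_le_len h _ u v).trans (Z.hopDist_le_bunchLen β S S' p u v)
  simp only [bunchGraph]
  split_ifs
  · exact le_top
  · exact le_min (h1 u v) ((G.dist_comm u v).le.trans (h1 v u))

theorem dist_le_partialHopset_len {G H' : WGraph V} (h : ∀ u v, G.dist u v ≤ H'.len u v)
    (A : ℕ → Set V) (p : ℕ → V → V) (β i : ℕ) (u v : V) :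
    G.dist u v ≤ (G.partialHopset H' A p β i).len u v := by
  induction i generalizing u v with
  | zero => exact le_top
  | succ i ih =>
    exact G.dist_le_union_len ih (dist_le_bunchGraph_len (G.dist_le_union_len
      (G.dist_le_union_len G.dist_le_len h) ih) _ _ _ _) u v

/-- A vertex outside the half-bunch is at least half as far away as the pivot; so the pivot exists
and is within `2 d`. -/
theorem hasBunches_bunchGraph {Z : WGraph V} {β : ℕ} {S S' : Set V} {p : V → V}
    (hp : ∀ u ∈ S \ S', Z.hopDistTo (8 * β) u S' < ⊤ →
      p u ∈ S' ∧ Z.hopDist (8 * β) u (p u) = Z.hopDistTo (8 * β) u S') :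
    HasBunches Z (Z.bunchGraph β S S' p) (4 * β) ⊤ S S' := by
  intro u hu v hv huv d hd _
  have hlen : ∀ w, u ≠ w → (Z.bunchGraph β S S' p).len u w ≤ Z.bunchLen β S S' p u w := by
    intro w hw
    simp only [bunchGraph, if_neg hw]
    exact min_le_left _ _
  by_cases hb : v ∈ Z.halfBunch β S S' u
  · left
    refine (hlen v huv).trans ?_
    rw [bunchLen, if_pos ⟨hu, hb⟩]
    exact hd
  · right
    have h1 : Z.hopDistTo (8 * β) u S' ≤ ENNReal.ofReal (2 * d) := by
      have : Z.hopDistTo (8 * β) u S' / 2 ≤ Z.hopDist (4 * β) u v := by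
        by_contra hlt
        exact hb ⟨hv, not_le.1 hlt⟩
      have := (ENNReal.div_le_iff (by simp) (by simp)).1 (this.trans hd)
      refine this.trans ?_
      rw [ENNReal.ofReal_mul (by norm_num), mul_comm]
      simp
    obtain ⟨hp1, hp2⟩ := hp u hu (h1.trans_lt ENNReal.ofReal_lt_top)
    refine ⟨p u, hp1, (hlen _ fun h => hu.2 (h ▸ hp1)).trans ?_⟩
    unfold bunchLen
    split_ifs with h2 h3
    -- The pivot may lie in the half-bunch itself. Its edge then gets the weight for `4 β` hops,
    -- which is below half of the pivot distance.
    · exact h2.2.2.le.trans (ENNReal.half_le_self.trans h1)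
    · exact hp2.le.trans h1
    · exact absurd ⟨hu, h1.trans_lt ENNReal.ofReal_lt_top, rfl⟩ h3

theorem HasBunches.mono_len {Z H H₂ : WGraph V} {E : ℕ} {M : ℝ≥0∞} {S S' : Set V}
    (h : HasBunches Z H E M S S') (hH : ∀ u v, H₂.len u v ≤ H.len u v) :
    HasBunches Z H₂ E M S S' := fun u hu v hv huv d hd hdM =>
  (h u hu v hv huv d hd hdM).imp (hH _ _).trans fun ⟨z, hz, h⟩ => ⟨z, hz, (hH _ _).trans h⟩

/-- A path of `2 L` edges consists of two pieces that the previous hopset handles with `β` hops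
each. Together with two side trips of at most `β` hops this fits the `4 β` hops of the half-bunches.
-/
theorem approxUnless_partialHopset [Finite V] {G H' : WGraph V} (hG : G.Positive)
    {k L β : ℕ} {σ δ : ℝ} {A : ℕ → Set V} {p : ℕ → V → V} (hσ : 1 ≤ σ) (hσ' : σ ≤ 5 / 4)
    (hδ : 0 < δ) (hδ' : δ < 1 / (15 * k)) (hk : 2 ≤ k) (hβ : β = ⌊(3 / δ) ^ k⌋₊)
    (hH' : G.IsHopsetUpTo H' β (σ - 1) L) (hA : IsHierarchy A k) (hp : G.ArePivots H' A p β)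
    {i : ℕ} (hi : i ≤ k) :
    ApproxUnless G (G ∪ G.partialHopset H' A p β (i + 1)) (2 * L) ⌊(3 / δ) ^ i⌋₊
      (σ * (1 + 12 * δ * i)) (A (i + 1)) := by
  have hk' : (2 : ℝ) ≤ k := by exact_mod_cast hk
  have hδk : δ * (15 * k) < 1 := by rwa [lt_div_iff₀ (by positivity)] at hδ'
  have h3 : 1 ≤ 3 / δ := by rw [le_div_iff₀ hδ]; nlinarith
  have hZ : ∀ i x y r, G.Shortest (2 * L) x y r →
      (G ∪ H' ∪ G.partialHopset H' A p β i).Reaches (2 * β) x y (σ * r) := fun i x y r h =>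
    (Shortest.reaches_mul (by linarith) (fun x y r h => hH'.reaches (by linarith) h) 2 h).mono_len
      fun u v => min_le_left _ _
  have hB : ∀ i, HasBunches (G ∪ H' ∪ G.partialHopset H' A p β i)
      (G.partialHopset H' A p β (i + 1)) (4 * β) ⊤ (A i) (A (i + 1)) := fun i =>
    (hasBunches_bunchGraph (hp i)).mono_len fun u v => min_le_right _ _
  induction i with
  | zero =>
    have := approxUnless_first (h := ⌊(3 / δ) ^ 0⌋₊) hσ' (hZ 0) (fun _ _ _ _ => le_top)
      (hA.1 ▸ hB 0) (by omega) (by simp)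
    simpa using this
  | succ i ih =>
    refine (ih (by omega)).next_level hG hσ hσ' hδ hδ' hk (by omega) (hZ (i + 1)) ?_ ?_
      (fun _ _ _ _ => le_top) (hB (i + 1)) ?_
    · exact fun u v => min_le_min (min_le_left _ _) le_rfl
    · exact fun u v => min_le_left _ _
    · have : ⌊(3 / δ) ^ i⌋₊ ≤ β := by
        rw [hβ]
        exact Nat.floor_le_floor (pow_le_pow_right₀ h3 (by omega))
      omega

/-- `2 ^ ℓ < n` gives `ℓ ≤ log n`, so the stretch accumulated before any scale stays below `5 / 4`.
-/
theorem pred_mul_le {n ℓ : ℕ} (hn : 2 ≤ n) (hℓ : ℓ < Nat.clog 2 n) {ε : ℝ} (hε : 0 < ε)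
    (hε' : ε < 1 / (5 * Real.logb 2 n)) : ℓ * ε ≤ 1 / 5 ∧ ε < 1 / 5 := by
  have hn' : (2 : ℝ) ≤ n := by exact_mod_cast hn
  have hlog : 1 ≤ Real.logb 2 n := by
    rw [Real.le_logb_iff_rpow_le (by norm_num) (by linarith)]; simpa using hn'
  have h1 : (ℓ : ℝ) ≤ Real.logb 2 n := by
    rw [Real.le_logb_iff_rpow_le (by norm_num) (by linarith), Real.rpow_natCast]
    exact_mod_cast (Nat.lt_clog_iff_pow_lt (by norm_num)).1 hℓ |>.le
  rw [lt_div_iff₀ (by linarith)] at hε'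
  constructor <;> nlinarith

theorem stretch_partialHopset (n : ℕ) (hn : 2 ≤ n) (G H' : WGraph (Fin n)) (hG : G.Positive)
    (k' ℓ : ℕ) (ε δ : ℝ) (A : ℕ → Set (Fin n)) (p : ℕ → Fin n → Fin n) (β : ℕ)
    (hk : 2 ≤ k') (hℓ : 1 ≤ ℓ) (hℓn : ℓ ≤ Nat.clog 2 n) (hε : 0 < ε)
    (hε' : ε < 1 / (5 * Real.logb 2 n)) (hδ : 0 < δ) (hδ' : δ < 1 / (15 * k'))
    (hβ : β = ⌊(3 / δ) ^ k'⌋₊)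
    (hH' : G.IsHopsetUpTo H' β ((1 + ε) ^ (ℓ - 1) - 1) (2 ^ (ℓ - 1)))
    (hA : WGraph.IsHierarchy A k') (hp : G.ArePivots H' A p β) (x y : Fin n)
    (hxy : G.dist x y = G.hopDist (2 ^ ℓ) x y) (i : ℕ) (hi : i ≤ k') :
    (G ∪ G.partialHopset H' A p β (i + 1)).hopDist ⌊(3 / δ) ^ i⌋₊ x y ≤
        ENNReal.ofReal ((1 + ε) ^ (ℓ - 1) * (1 + 12 * δ * i)) * G.dist x y ∨
      ∃ z ∈ A (i + 1),
        (G ∪ G.partialHopset H' A p β (i + 1)).hopDist ⌊(3 / δ) ^ i⌋₊ x z ≤ 3 * G.dist x y := by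
  have hσ : 1 ≤ (1 + ε) ^ (ℓ - 1) := one_le_pow₀ (by linarith)
  have h := approxUnless_partialHopset hG hσ
    (one_add_pow_le hε.le (pred_mul_le hn (by omega) hε hε').1) hδ hδ' hk hβ hH' hA hp hi
  rw [← pow_succ', Nat.sub_add_cancel hℓ] at h
  exact h.of_dist_eq (by positivity) hxy

theorem isHopset_iterate (n : ℕ) (hn : 2 ≤ n) (G : WGraph (Fin n)) (hG : G.Positive)
    (k' : ℕ) (ε : ℝ) (β : ℕ) (H : ℕ → WGraph (Fin n)) (hk : 2 ≤ k') (hε : 0 < ε)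
    (hε' : ε < 1 / (5 * Real.logb 2 n)) (hβ : β = ⌊(45 * k' / ε) ^ k'⌋₊) (hH0 : H 0 = ∅)
    (hH : ∀ ℓ < Nat.clog 2 n, G.IsNextScale (H ℓ) (H (ℓ + 1)) k' β) :
    (∀ ℓ ≤ Nat.clog 2 n, G.IsHopsetUpTo (H ℓ) β ((1 + ε) ^ ℓ - 1) (2 ^ ℓ)) ∧
      G.IsHopset (H (Nat.clog 2 n)) β ((1 + ε) ^ Nat.clog 2 n - 1) := by
  have hk0 : (2 : ℝ) ≤ k' := by exact_mod_cast hk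
  -- Then `3 / δ = 45 k' / ε`, and `12 δ k' = 4 ε / 5`, so that one scale multiplies the stretch by
  -- at most `1 + ε`.
  set δ := ε / (15 * k') with hδ
  have hδ0 : 0 < δ := by positivity
  have h3 : 45 * k' / ε = 3 / δ := by rw [hδ]; field_simp; norm_num
  rw [h3] at hβ
  have hε5 : ε < 1 / 5 := by
    refine (pred_mul_le hn (ℓ := 0) ?_ hε hε').2
    exact Nat.clog_pos (by norm_num) hn
  have hδ' : δ < 1 / (15 * k') := by rw [hδ]; gcongr; linarith
  have hδk : δ * (15 * k') = ε := by rw [hδ]; field_simp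
  have hβ1 : 1 ≤ β := by
    rw [hβ]
    refine Nat.le_floor ?_
    simpa using one_le_pow₀ (M₀ := ℝ) (by rw [le_div_iff₀ hδ0]; nlinarith)
  have key : ∀ ℓ ≤ Nat.clog 2 n, G.IsHopsetUpTo (H ℓ) β ((1 + ε) ^ ℓ - 1) (2 ^ ℓ) := by
    intro ℓ
    induction ℓ with
    | zero => intro _; rw [hH0]; simpa using G.isHopsetUpTo_empty hβ1
    | succ ℓ ih =>
      intro hℓ
      have hℓ' := ih (by omega)
      obtain ⟨A, p, hA, hp, hHA⟩ := hH ℓ (by omega)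
      have hσ : 1 ≤ (1 + ε) ^ ℓ := one_le_pow₀ (by linarith)
      have h := approxUnless_partialHopset hG hσ
        (one_add_pow_le hε.le (pred_mul_le hn (by omega) hε hε').1) hδ0 hδ' hk hβ hℓ' hA hp le_rfl
      -- The set after the last one is empty, which excludes the second alternative.
      rw [hA.2.2, ← pow_succ', ← hHA, ← hβ] at h
      refine h.isHopsetUpTo (by positivity) ?_ ?_
      · rw [add_sub_cancel, pow_succ]
        gcongr
        nlinarith
      · rw [hHA]
        exact dist_le_partialHopset_len hℓ'.1 A p β (k' + 1)
  exact ⟨key, (key _ le_rfl).isHopset (by simpa using Nat.le_pow_clog (by norm_num) n)⟩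

end WGraph

/-! ### Random samples -/

/-- The summands are the probabilities of the outcomes of sampling `A` at rate `q`. A sample that
misses `B` is a subset of `A \ B`, and the binomial theorem gives the probability of that event. All
probabilistic arguments are such finite sums. -/
theorem sum_sample_disjoint {α : Type*} [DecidableEq α] {A B : Finset α} (hB : B ⊆ A) (q : ℝ) :
    ∑ S ∈ A.powerset with Disjoint S B, q ^ S.card * (1 - q) ^ (A.card - S.card) =
      (1 - q) ^ B.card := by
  have h : A.powerset.filter (fun S => Disjoint S B) = (A \ B).powerset := by
    ext S
    simp only [Finset.mem_filter, Finset.mem_powerset, Finset.subset_sdiff]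
  have hc := Finset.card_sdiff_add_card_eq_card hB
  calc _ = ∑ S ∈ (A \ B).powerset, q ^ S.card * (1 - q) ^ ((A \ B).card - S.card) *
        (1 - q) ^ B.card := by
        rw [h]
        refine Finset.sum_congr rfl fun S hS => ?_
        have := Finset.card_le_card (Finset.mem_powerset.1 hS)
        rw [mul_assoc, ← pow_add]
        congr 2
        omega
    _ = _ := by
        rw [← Finset.sum_mul, Finset.sum_pow_mul_eq_add_pow]
        simp

theorem sum_sample {α : Type*} [DecidableEq α] (A : Finset α) (q : ℝ) :
    ∑ S ∈ A.powerset, q ^ S.card * (1 - q) ^ (A.card - S.card) = 1 := by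
  rw [Finset.sum_pow_mul_eq_add_pow]; simp

/-- The indicator of `a ∈ S` is one minus the indicator that `S` misses `{a}`. -/
theorem sum_sample_card {α : Type*} [DecidableEq α] (A : Finset α) (q : ℝ) :
    ∑ S ∈ A.powerset, q ^ S.card * (1 - q) ^ (A.card - S.card) * S.card = A.card * q := by
  have h : ∀ S ∈ A.powerset, q ^ S.card * (1 - q) ^ (A.card - S.card) * S.card =
      ∑ a ∈ A, (q ^ S.card * (1 - q) ^ (A.card - S.card) -
        if Disjoint S {a} then q ^ S.card * (1 - q) ^ (A.card - S.card) else 0) := by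
    intro S hS
    have h1 : (S.card : ℝ) = ∑ a ∈ A, if a ∈ S then 1 else 0 := by
      rw [Finset.sum_boole, Finset.filter_mem_eq_inter,
        Finset.inter_eq_right.2 (Finset.mem_powerset.1 hS)]
    rw [h1, Finset.mul_sum]
    refine Finset.sum_congr rfl fun a _ => ?_
    by_cases ha : a ∈ S <;> simp [ha]
  rw [Finset.sum_congr rfl h, Finset.sum_comm]
  have h2 : ∀ a ∈ A, ∑ S ∈ A.powerset, (q ^ S.card * (1 - q) ^ (A.card - S.card) -
        if Disjoint S {a} then q ^ S.card * (1 - q) ^ (A.card - S.card) else 0) = q := by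
    intro a ha
    rw [Finset.sum_sub_distrib, sum_sample, ← Finset.sum_filter,
      sum_sample_disjoint (Finset.singleton_subset_iff.2 ha)]
    simp
  rw [Finset.sum_congr rfl h2]
  simp

namespace WGraph

/-! ### Nearest vertices -/

section Lists

variable {n : ℕ}

/-- `w'` comes before `w` if the vertices are ordered by the value of `f`, and then by name. -/
def Before (f : Fin n → ℝ≥0∞) (w' w : Fin n) : Prop := f w' < f w ∨ f w' = f w ∧ w' < w

theorem Before.le {f : Fin n → ℝ≥0∞} {w' w : Fin n} (h : Before f w' w) : f w' ≤ f w :=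
  h.elim le_of_lt fun h => h.1.le

theorem Before.trans {f : Fin n → ℝ≥0∞} {a b c : Fin n} (h : Before f a b) (h' : Before f b c) :
    Before f a c := by
  unfold Before at *
  rcases h with h | h <;> rcases h' with h' | h'
  · exact .inl (h.trans h')
  · exact .inl (h'.1 ▸ h)
  · exact .inl (h.1 ▸ h')
  · exact .inr ⟨h.1.trans h'.1, h.2.trans h'.2⟩

theorem Before.irrefl {f : Fin n → ℝ≥0∞} (a : Fin n) : ¬ Before f a a := by simp [Before]

theorem Before.total (f : Fin n → ℝ≥0∞) {a b : Fin n} (h : a ≠ b) : Before f a b ∨ Before f b a := by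
  unfold Before
  rcases lt_trichotomy (f a) (f b) with h1 | h1 | h1
  · simp [h1]
  · rcases lt_or_gt_of_ne h with h2 | h2 <;> simp [h1, h2]
  · simp [h1]

open Classical in
/-- The number of vertices before `w`. -/
noncomputable def rank (f : Fin n → ℝ≥0∞) (w : Fin n) : ℕ :=
  (Finset.univ.filter fun w' => Before f w' w).card

theorem rank_lt_of_before {f : Fin n → ℝ≥0∞} {a b : Fin n} (h : Before f a b) :
    rank f a < rank f b := by
  classical
  refine Finset.card_lt_card ((Finset.ssubset_iff_of_subset fun w hw => ?_).2 ⟨a, ?_, ?_⟩)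
  · simp only [Finset.mem_filter, Finset.mem_univ, true_and] at hw ⊢
    exact hw.trans h
  · simpa using h
  · simpa using Before.irrefl a

theorem rank_injective (f : Fin n → ℝ≥0∞) : Function.Injective (rank f) := by
  intro a b h
  by_contra hne
  rcases Before.total f hne with h1 | h1 <;> have := rank_lt_of_before h1 <;> omega

theorem before_of_rank_lt {f : Fin n → ℝ≥0∞} {a b : Fin n} (h : rank f a < rank f b) :
    Before f a b := by
  rcases Before.total f (a := a) (b := b) (by rintro rfl; exact lt_irrefl _ h) with h1 | h1
  · exact h1
  · have := rank_lt_of_before h1; omega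

theorem rank_lt (f : Fin n → ℝ≥0∞) (a : Fin n) : rank f a < n := by
  classical
  have : rank f a < (Finset.univ : Finset (Fin n)).card :=
    Finset.card_lt_card ((Finset.ssubset_iff_of_subset (Finset.subset_univ _)).2
      ⟨a, Finset.mem_univ _, by simpa using Before.irrefl a⟩)
  simpa using this

theorem rank_le_rank {f g : Fin n → ℝ≥0∞} {a : Fin n} (h : ∀ b, Before f b a → Before g b a) :
    rank f a ≤ rank g a := by
  classical
  refine Finset.card_le_card fun w hw => ?_
  simp only [Finset.mem_filter, Finset.mem_univ, true_and] at hw ⊢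
  exact h w hw

theorem card_rank_lt_le (f : Fin n → ℝ≥0∞) (K : ℕ) :
    (Finset.univ.filter fun w => rank f w < K).card ≤ K := by
  rw [← Finset.card_range K]
  exact Finset.card_le_card_of_injOn (rank f) (fun w hw => by simpa using hw)
    (rank_injective f).injOn

theorem le_card_rank_lt (f : Fin n → ℝ≥0∞) {K : ℕ} {v : Fin n} (h : K ≤ rank f v) :
    K ≤ (Finset.univ.filter fun w => rank f w < K).card := by
  have hbij : Function.Bijective (fun w => (⟨rank f w, rank_lt f w⟩ : Fin n)) :=
    Finite.injective_iff_bijective.1 fun a b hab => rank_injective f (by simpa using hab)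
  have hK : K ≤ n := h.trans (rank_lt f v).le
  calc K = (Finset.range K).card := (Finset.card_range K).symm
    _ ≤ ((Finset.univ.filter fun w => rank f w < K).image (rank f)).card := by
        refine Finset.card_le_card fun j hj => ?_
        have hj' : j < K := by simpa using hj
        obtain ⟨w, hw⟩ := hbij.2 ⟨j, by omega⟩
        have hw' : rank f w = j := by simpa using hw
        exact Finset.mem_image.2 ⟨w, by simp [hw', hj'], hw'⟩
    _ ≤ _ := Finset.card_image_le

open Classical in
/-- The vertices with a finite value. -/
noncomputable def supp (f : Fin n → ℝ≥0∞) : Finset (Fin n) := Finset.univ.filter fun w => f w ≠ ⊤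

theorem mem_supp {f : Fin n → ℝ≥0∞} {w : Fin n} : w ∈ supp f ↔ f w ≠ ⊤ := by simp [supp]

open Classical in
/-- The vertices in the list `f` up to the first one in `S`. -/
noncomputable def bunch (f : Fin n → ℝ≥0∞) (S : Finset (Fin n)) : Finset (Fin n) :=
  (supp f).filter fun w => ∀ z ∈ S, ¬ Before f z w

theorem mem_bunch {f : Fin n → ℝ≥0∞} {S : Finset (Fin n)} {w : Fin n} :
    w ∈ bunch f S ↔ f w ≠ ⊤ ∧ ∀ z ∈ S, ¬ Before f z w := by simp [bunch, mem_supp]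

theorem exists_mem_bunch {f : Fin n → ℝ≥0∞} {S : Finset (Fin n)} {z : Fin n} (hz : z ∈ S)
    (hf : f z ≠ ⊤) : ∃ w ∈ S, w ∈ bunch f S ∧ f w ≤ f z := by
  obtain ⟨w, hw, hmin⟩ := Finset.exists_min_image S (rank f) ⟨z, hz⟩
  have hwz : f w ≤ f z := by
    by_contra hlt
    have := rank_lt_of_before (f := f) (.inl (not_le.1 hlt))
    have := hmin z hz
    omega
  refine ⟨w, hw, mem_bunch.2 ⟨ne_top_of_le_ne_top hf hwz, fun z' hz' hb => ?_⟩, hwz⟩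
  have := rank_lt_of_before hb
  have := hmin z' hz'
  omega

/-- `w` is in the bunch exactly if the sample misses all its predecessors, which has probability `(1
- q) ^ rank f w`. Ranks are distinct, so a geometric series bounds the mean. -/
theorem sum_sample_bunch (A : Finset (Fin n)) {f : Fin n → ℝ≥0∞} (hf : ∀ w, f w ≠ ⊤ → w ∈ A)
    {q : ℝ} (hq : 0 < q) (hq1 : q ≤ 1) :
    ∑ S ∈ A.powerset, q ^ S.card * (1 - q) ^ (A.card - S.card) * (bunch f S).card ≤ 1 / q := by
  classical
  set μ : Finset (Fin n) → ℝ := fun S => q ^ S.card * (1 - q) ^ (A.card - S.card) with hμ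
  have h1 : ∀ S ∈ A.powerset, μ S * (bunch f S).card =
      ∑ w ∈ supp f, if Disjoint S (Finset.univ.filter fun z => Before f z w) then μ S else 0 := by
    intro S _
    rw [← Finset.sum_filter, Finset.sum_const, nsmul_eq_mul, mul_comm, bunch]
    congr 3
    ext w
    simp only [Finset.mem_filter, Finset.disjoint_left, Finset.mem_univ, true_and]
  have h2 : ∀ w ∈ supp f, (∑ S ∈ A.powerset,
      if Disjoint S (Finset.univ.filter fun z => Before f z w) then μ S else 0) =
        (1 - q) ^ rank f w := by
    intro w hw
    rw [← Finset.sum_filter]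
    refine sum_sample_disjoint (fun z hz => ?_) q
    simp only [Finset.mem_filter, Finset.mem_univ, true_and] at hz
    exact hf z (ne_top_of_le_ne_top (mem_supp.1 hw) hz.le)
  have h3 : ∑ w ∈ supp f, (1 - q) ^ rank f w ≤ ∑ j ∈ Finset.range n, (1 - q) ^ j := by
    rw [← Finset.sum_image (f := fun j => (1 - q) ^ j) (rank_injective f).injOn]
    refine Finset.sum_le_sum_of_subset_of_nonneg (fun j hj => ?_) fun j _ _ =>
      pow_nonneg (by linarith) _
    obtain ⟨w, _, rfl⟩ := Finset.mem_image.1 hj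
    simpa using rank_lt f w
  change ∑ S ∈ A.powerset, μ S * (bunch f S).card ≤ 1 / q
  rw [Finset.sum_congr rfl h1, Finset.sum_comm, Finset.sum_congr rfl h2]
  refine h3.trans ?_
  rw [le_div_iff₀ hq]
  have := geom_sum_mul (1 - q) n
  have h4 : 0 ≤ (1 - q) ^ n := pow_nonneg (by linarith) _
  nlinarith

/-- A small subset of `A` that meets every list with at least `K` vertices, and meets the lists
early on average. -/
theorem exists_sample (A : Finset (Fin n)) {f : Fin n → Fin n → ℝ≥0∞}
    (hf : ∀ u w, f u w ≠ ⊤ → w ∈ A) {b K : ℕ} (hb : 1 ≤ b)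
    (hK : A.card * (1 - 1 / (4 * b : ℝ)) ^ K < 1 / 4) :
    ∃ S ⊆ A, S.card * (2 * b) ≤ A.card ∧ ∑ u ∈ A, (bunch (f u) S).card ≤ 16 * (A.card * b) ∧
      ∀ u ∈ A, K ≤ (supp (f u)).card → ∃ z ∈ S, f u z ≠ ⊤ := by
  classical
  rcases A.eq_empty_or_nonempty with rfl | hA
  · exact ⟨∅, by simp⟩
  have hb' : (1 : ℝ) ≤ b := by exact_mod_cast hb
  have hA' : (1 : ℝ) ≤ A.card := by exact_mod_cast hA.card_pos
  set q : ℝ := 1 / (4 * b) with hq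
  have hq0 : 0 < q := by positivity
  have hq1 : q ≤ 1 := by rw [hq, div_le_one (by positivity)]; linarith
  set μ : Finset (Fin n) → ℝ := fun S => q ^ S.card * (1 - q) ^ (A.card - S.card) with hμ
  have hμ0 : ∀ S, 0 ≤ μ S := fun S => mul_nonneg (pow_nonneg hq0.le _) (pow_nonneg (by linarith) _)
  -- With `q = 1 / (4 b)` the three terms have means `1 / 2`, at most `1 / 4`, and less than `1 /
  -- 4`. So some `S` has `X S < 1`, and each nonnegative term is then below `1`, which is one of the
  -- three required properties.
  set X : Finset (Fin n) → ℝ := fun S => S.card * (2 * b / A.card) +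
    (∑ u ∈ A, ((bunch (f u) S).card : ℝ)) * (1 / (16 * (A.card * b))) +
    ∑ u ∈ A, if K ≤ (supp (f u)).card ∧ Disjoint S (supp (f u)) then 1 else 0 with hX
  have e1 : ∑ S ∈ A.powerset, μ S * (S.card * (2 * b / A.card)) = 1 / 2 := by
    simp_rw [← mul_assoc]
    rw [← Finset.sum_mul, sum_sample_card, hq]
    field_simp; norm_num
  have e2 : ∑ S ∈ A.powerset, μ S * ((∑ u ∈ A, ((bunch (f u) S).card : ℝ)) *
      (1 / (16 * (A.card * b)))) ≤ 1 / 4 := by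
    have hfac : ∀ S, μ S * ((∑ u ∈ A, ((bunch (f u) S).card : ℝ)) * (1 / (16 * (A.card * b)))) =
        μ S * (∑ u ∈ A, ((bunch (f u) S).card : ℝ)) * (1 / (16 * (A.card * b))) :=
      fun S => (mul_assoc _ _ _).symm
    rw [Finset.sum_congr rfl fun S _ => hfac S, ← Finset.sum_mul]
    simp_rw [Finset.mul_sum]
    rw [Finset.sum_comm]
    have : ∑ u ∈ A, ∑ S ∈ A.powerset, μ S * (bunch (f u) S).card ≤ A.card * (1 / q) := by
      rw [← nsmul_eq_mul]
      exact Finset.sum_le_card_nsmul _ _ _ fun u _ => sum_sample_bunch A (hf u) hq0 hq1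
    have h2 : (1 : ℝ) / q = 4 * b := by rw [hq]; simp
    rw [h2] at this
    calc _ ≤ A.card * (4 * b) * (1 / (16 * ((A.card : ℝ) * b))) :=
          mul_le_mul_of_nonneg_right this (by positivity)
      _ = 1 / 4 := by field_simp; norm_num
  have e3 : ∑ S ∈ A.powerset, μ S * (∑ u ∈ A,
      if K ≤ (supp (f u)).card ∧ Disjoint S (supp (f u)) then (1 : ℝ) else 0) < 1 / 4 := by
    refine lt_of_le_of_lt ?_ hK
    simp_rw [Finset.mul_sum]
    rw [Finset.sum_comm, ← nsmul_eq_mul]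
    refine Finset.sum_le_card_nsmul _ _ _ fun u _ => ?_
    by_cases hu : K ≤ (supp (f u)).card
    · simp only [hu, true_and, mul_ite, mul_one, mul_zero]
      rw [← Finset.sum_filter]
      have := sum_sample_disjoint (A := A) (B := supp (f u))
        (fun w hw => hf u w (mem_supp.1 hw)) q
      rw [this]
      exact pow_le_pow_of_le_one (by linarith) (by linarith) hu
    · simp only [hu, false_and, if_false, mul_zero, Finset.sum_const_zero]
      exact pow_nonneg (by linarith) _
  have hlt : ∑ S ∈ A.powerset, μ S * X S < ∑ S ∈ A.powerset, μ S * 1 := by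
    simp only [hX, mul_add, Finset.sum_add_distrib, mul_one]
    have e4 : ∑ S ∈ A.powerset, μ S = 1 := sum_sample A q
    linarith
  obtain ⟨S, hS, hSX⟩ := Finset.exists_lt_of_sum_lt hlt
  have hX1 : X S < 1 := lt_of_mul_lt_mul_left hSX (hμ0 S)
  have p1 : 0 ≤ S.card * (2 * b / A.card : ℝ) := by positivity
  have p2 : 0 ≤ (∑ u ∈ A, ((bunch (f u) S).card : ℝ)) * (1 / (16 * (A.card * b))) :=
    mul_nonneg (Finset.sum_nonneg fun _ _ => Nat.cast_nonneg _) (by positivity)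
  have p3 : ∀ u ∈ A, (0 : ℝ) ≤ if K ≤ (supp (f u)).card ∧ Disjoint S (supp (f u)) then 1 else 0 :=
    fun u _ => by split_ifs; exacts [zero_le_one, le_rfl]
  have p3' := Finset.sum_nonneg p3
  simp only [hX] at hX1
  refine ⟨S, Finset.mem_powerset.1 hS, ?_, ?_, fun u hu hKu => ?_⟩
  · have : S.card * (2 * b / A.card : ℝ) ≤ 1 := by linarith
    rw [← mul_div_assoc, div_le_one (by linarith)] at this
    exact_mod_cast this
  · have : (∑ u ∈ A, ((bunch (f u) S).card : ℝ)) * (1 / (16 * (A.card * b))) ≤ 1 := by linarith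
    rw [mul_one_div, div_le_one (by positivity)] at this
    exact_mod_cast this
  -- The third term counts the long lists that `S` misses; a single one would make `X S ≥ 1`.
  · by_contra hno
    push Not at hno
    have h1 := Finset.single_le_sum p3 hu
    rw [if_pos ⟨hKu, Finset.disjoint_left.2 fun z hz hz' => mem_supp.1 hz' (hno z hz)⟩] at h1
    linarith

/-- `4 b` entries reduce the chance of a miss by a factor of at most `1 / e ≤ 1 / 2`; so `clog n +
3` such blocks leave at most `1 / 8` over all lists together. -/
theorem sample_condition {n b K m : ℕ} (hb : 1 ≤ b) (hm : m ≤ n)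
    (hK : 4 * b * (Nat.clog 2 n + 3) ≤ K) : (m : ℝ) * (1 - 1 / (4 * b : ℝ)) ^ K < 1 / 4 := by
  have hb' : (1 : ℝ) ≤ b := by exact_mod_cast hb
  have h0 : (0 : ℝ) ≤ 1 - 1 / (4 * b) := by
    rw [sub_nonneg, div_le_one (by positivity)]; linarith
  have h1 : (1 - 1 / (4 * b : ℝ)) ^ (4 * b) ≤ 1 / 2 := by
    have h2 : (1 - 1 / (4 * b : ℝ)) ≤ Real.exp (-(1 / (4 * b))) := by
      linarith [Real.add_one_le_exp (-(1 / (4 * b : ℝ)))]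
    calc (1 - 1 / (4 * b : ℝ)) ^ (4 * b) ≤ Real.exp (-(1 / (4 * b))) ^ (4 * b) := by gcongr
      _ = Real.exp (-1) := by
          rw [← Real.exp_nat_mul]; congr 1; push_cast; field_simp
      _ ≤ 1 / 2 := by
          rw [Real.exp_neg, inv_eq_one_div]
          gcongr
          linarith [Real.add_one_le_exp (1 : ℝ)]
  have hn : (n : ℝ) ≤ 2 ^ Nat.clog 2 n := by exact_mod_cast Nat.le_pow_clog (by norm_num) n
  have hm' : (m : ℝ) ≤ n := by exact_mod_cast hm
  calc (m : ℝ) * (1 - 1 / (4 * b : ℝ)) ^ K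
      ≤ 2 ^ Nat.clog 2 n * (1 - 1 / (4 * b : ℝ)) ^ (4 * b * (Nat.clog 2 n + 3)) := by
        exact mul_le_mul (hm'.trans hn)
          (pow_le_pow_of_le_one h0 (sub_le_self _ (by positivity)) hK) (pow_nonneg h0 _)
          (by positivity)
    _ ≤ 2 ^ Nat.clog 2 n * (1 / 2) ^ (Nat.clog 2 n + 3) := by
        rw [pow_mul]
        have := pow_nonneg h0 (4 * b)
        gcongr
    _ = 1 / 8 := by
        rw [pow_add, ← mul_assoc, ← mul_pow]; norm_num
    _ < 1 / 4 := by norm_num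

end Lists

end WGraph

/-! ### Truncated lists of nearest vertices, and the edges they define. -/

namespace WGraph

section Lists

variable {n : ℕ}

open Classical in
/-- The first `K` values of `f`, without those above `M`. -/
noncomputable def truncate (K : ℕ) (M : ℝ≥0∞) (f : Fin n → ℝ≥0∞) (w : Fin n) : ℝ≥0∞ :=
  if f w ≤ M ∧ rank f w < K then f w else ⊤

theorem le_truncate (K : ℕ) (M : ℝ≥0∞) (f : Fin n → ℝ≥0∞) (w : Fin n) : f w ≤ truncate K M f w := by
  unfold truncate
  split_ifs
  · exact le_rfl
  · exact le_top

theorem card_supp_truncate_le (K : ℕ) (M : ℝ≥0∞) (f : Fin n → ℝ≥0∞) :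
    (supp (truncate K M f)).card ≤ K := by
  refine (Finset.card_le_card fun w hw => ?_).trans (card_rank_lt_le f K)
  rw [mem_supp, truncate] at hw
  simp only [Finset.mem_filter, Finset.mem_univ, true_and]
  by_contra h
  exact hw (if_neg fun h' => h h'.2)

open Classical in
/-- The value `0` at `v`, if `v ∈ A`. -/
noncomputable def source (A : Finset (Fin n)) (v w : Fin n) : ℝ≥0∞ := if v = w ∧ w ∈ A then 0 else ⊤

/-- The new list of `v` when the others have the lists `f`, and `z` are the lengths of the edges at
`v`. -/
noncomputable def extend (A : Finset (Fin n)) (K : ℕ) (M : ℝ≥0∞) (f : Fin n → Fin n → ℝ≥0∞)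
    (z : Fin n → ℝ≥0∞) (v : Fin n) : Fin n → ℝ≥0∞ :=
  truncate K M fun w => min (source A v w) (⨅ x, z x + f x w)

open Classical in
/-- The `t`-bounded distances to the vertices of `A`. -/
noncomputable def distIn (Z : WGraph (Fin n)) (A : Finset (Fin n)) (t : ℕ) (v w : Fin n) : ℝ≥0∞ :=
  if w ∈ A then Z.hopDist t v w else ⊤

theorem distIn_zero (Z : WGraph (Fin n)) (A : Finset (Fin n)) (v w : Fin n) :
    Z.distIn A 0 v w = source A v w := by
  unfold distIn source
  by_cases hw : w ∈ A
  · by_cases h : v = w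
    · subst h; simp [hw, hopDist_self]
    · simp [hw, h, hopDist_zero Z h]
  · simp [hw]

theorem distIn_succ (Z : WGraph (Fin n)) (A : Finset (Fin n)) (t : ℕ) (v w : Fin n) :
    Z.distIn A (t + 1) v w = min (source A v w) (⨅ x, Z.len v x + Z.distIn A t x w) := by
  unfold distIn source
  by_cases hw : w ∈ A
  · by_cases h : v = w
    · subst h; simp [hw, hopDist_self]
    · simp [hw, h, hopDist_succ Z t h]
  · simp [hw]

/-- `f v` are the `K` vertices of `A` that are nearest to `v` with `t` edges, up to distance `M`. -/
structure IsLists (Z : WGraph (Fin n)) (A : Finset (Fin n)) (K : ℕ) (M : ℝ≥0∞) (t : ℕ)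
    (f : Fin n → Fin n → ℝ≥0∞) : Prop where
  distIn_le : ∀ v w, Z.distIn A t v w ≤ f v w
  eq_distIn : ∀ v w, Z.distIn A t v w ≤ M → rank (Z.distIn A t v) w < K → f v w = Z.distIn A t v w
  card_supp : ∀ v, (supp (f v)).card ≤ K

theorem isLists_source (Z : WGraph (Fin n)) (A : Finset (Fin n)) {K : ℕ} (hK : 1 ≤ K) (M : ℝ≥0∞) :
    IsLists Z A K M 0 (source A) where
  distIn_le v w := (Z.distIn_zero A v w).le
  eq_distIn v w _ _ := (Z.distIn_zero A v w).symm
  card_supp v := by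
    refine (Finset.card_le_card (t := {v}) fun w hw => ?_).trans (by simpa using hK)
    rw [mem_supp, source] at hw
    by_contra h
    exact hw (if_neg fun h' => h (by simp [h'.1]))

/-- If a shortest path from `v` to one of its `K` nearest vertices starts with the edge to `x`, then
this vertex is among the `K` nearest of `x`, with one edge less: whatever precedes it for `x` also
precedes it for `v`. Other entries may be too large, but never too small. -/
theorem IsLists.extend {Z : WGraph (Fin n)} {A : Finset (Fin n)} {K : ℕ} {M : ℝ≥0∞} (hM : M ≠ ⊤)
    {t : ℕ} {f : Fin n → Fin n → ℝ≥0∞} (h : IsLists Z A K M t f) :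
    IsLists Z A K M (t + 1) fun v => extend A K M f (Z.len v) v := by
  have h1 : ∀ v w, Z.distIn A (t + 1) v w ≤ min (source A v w) (⨅ x, Z.len v x + f x w) := by
    intro v w
    rw [distIn_succ]
    exact min_le_min le_rfl (iInf_mono fun x => add_le_add le_rfl (h.distIn_le x w))
  refine ⟨fun v w => (h1 v w).trans (le_truncate _ _ _ _), fun v w hwM hwK => ?_,
    fun v => card_supp_truncate_le _ _ _⟩
  have h2 : min (source A v w) (⨅ x, Z.len v x + f x w) = Z.distIn A (t + 1) v w := by
    refine le_antisymm ?_ (h1 v w)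
    by_cases hs : source A v w ≤ ⨅ x, Z.len v x + Z.distIn A t x w
    · rw [distIn_succ, min_eq_left hs]
      exact min_le_left _ _
    · have : Nonempty (Fin n) := ⟨v⟩
      obtain ⟨x, hx⟩ := exists_eq_ciInf_of_finite (f := fun x => Z.len v x + Z.distIn A t x w)
      have hx' : Z.distIn A (t + 1) v w = Z.len v x + Z.distIn A t x w := by
        rw [distIn_succ, min_eq_right (not_le.1 hs).le, ← hx]
      have hxM : Z.len v x + Z.distIn A t x w ≤ M := hx' ▸ hwM
      have hlen : Z.len v x ≠ ⊤ := ne_top_of_le_ne_top hM (le_self_add.trans hxM)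
      have hle : ∀ w', Z.distIn A (t + 1) v w' ≤ Z.len v x + Z.distIn A t x w' := fun w' => by
        rw [distIn_succ]
        exact (min_le_right _ _).trans (iInf_le _ x)
      have hrank : rank (Z.distIn A t x) w ≤ rank (Z.distIn A (t + 1) v) w := by
        refine rank_le_rank fun w' hw' => ?_
        rcases hw' with hlt | ⟨heq, hlt⟩
        · refine .inl ((hle w').trans_lt ?_)
          rw [hx']
          exact ENNReal.add_lt_add_left hlen hlt
        · rcases (hle w').lt_or_eq with h3 | h3
          · exact .inl (by rw [hx', ← heq]; exact h3)
          · exact .inr ⟨by rw [hx', ← heq]; exact h3, hlt⟩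
      rw [hx', ← h.eq_distIn x w (le_add_self.trans hxM) (hrank.trans_lt hwK)]
      exact (min_le_right _ _).trans (iInf_le _ x)
  -- The computed values are at least the distances, with equality at `w`; so `w` has no more
  -- predecessors than before and survives the truncation.
  have h3 : rank (fun w => min (source A v w) (⨅ x, Z.len v x + f x w)) w ≤
      rank (Z.distIn A (t + 1) v) w := by
    refine rank_le_rank fun w' hw' => ?_
    rcases hw' with hlt | ⟨heq, hlt⟩
    · exact .inl ((h1 v w').trans_lt (by rw [← h2]; exact hlt))
    · beta_reduce at heq
      rcases (h1 v w').lt_or_eq with h4 | h4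
      · exact .inl (by rw [← h2, ← heq]; exact h4)
      · exact .inr ⟨by rw [← h2, ← heq]; exact h4, hlt⟩
  unfold WGraph.extend truncate
  rw [if_pos ⟨h2.le.trans hwM, h3.trans_lt hwK⟩]
  exact h2

open Classical in
/-- The edges from the vertices of `A \ S` to their bunches. -/
noncomputable def listGraph (A S : Finset (Fin n)) (f : Fin n → Fin n → ℝ≥0∞) :
    WGraph (Fin n) where
  len u v := if u = v then ⊤ else
    min (if u ∈ A \ S ∧ v ∈ bunch (f u) S then f u v else ⊤)
      (if v ∈ A \ S ∧ u ∈ bunch (f v) S then f v u else ⊤)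
  len_comm u v := by simp only [eq_comm (a := u), min_comm]
  len_self v := by simp

theorem listGraph_len_mem (A S : Finset (Fin n)) (f : Fin n → Fin n → ℝ≥0∞) (u v : Fin n) :
    (listGraph A S f).len u v = ⊤ ∨ (listGraph A S f).len u v = f u v ∨
      (listGraph A S f).len u v = f v u := by
  simp only [listGraph]
  split_ifs <;> simp [min_choice, -inf_eq_left, -inf_eq_right]

theorem dist_le_listGraph_len {G Z : WGraph (Fin n)} (hG : ∀ u v, G.dist u v ≤ Z.len u v)
    {A : Finset (Fin n)} {K : ℕ} {M : ℝ≥0∞} {t : ℕ} {f : Fin n → Fin n → ℝ≥0∞}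
    (h : IsLists Z A K M t f) (S : Finset (Fin n)) (u v : Fin n) :
    G.dist u v ≤ (listGraph A S f).len u v := by
  have h1 : ∀ u v, G.dist u v ≤ f u v := fun u v => by
    refine le_trans ?_ (h.distIn_le u v)
    unfold distIn
    split_ifs
    · exact dist_le_hopDist_of_dist_le_len hG t u v
    · exact le_top
  rcases listGraph_len_mem A S f u v with h2 | h2 | h2 <;> rw [h2]
  · exact le_top
  · exact h1 u v
  · exact (G.dist_comm u v).le.trans (h1 v u)

theorem IsLists.mem_of_ne_top {Z : WGraph (Fin n)} {A : Finset (Fin n)} {K : ℕ} {M : ℝ≥0∞} {t : ℕ}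
    {f : Fin n → Fin n → ℝ≥0∞} (h : IsLists Z A K M t f) {v w : Fin n} (hw : f v w ≠ ⊤) : w ∈ A := by
  have := ne_top_of_le_ne_top hw (h.distIn_le v w)
  by_contra hA
  exact this (if_neg hA)

/-- A vertex `v` missing from the bunch of `u` is missing because a vertex of `S` is at most as far
away, or because the list of `u` is full of vertices no farther than `v`, and full lists meet `S`.
So the edge to `S'` weighs even at most `d`. -/
theorem IsLists.hasBunches {Z : WGraph (Fin n)} {A : Finset (Fin n)} {K : ℕ} {M : ℝ≥0∞}
    (hM : M ≠ ⊤) {t : ℕ} {f : Fin n → Fin n → ℝ≥0∞} (h : IsLists Z A K M t f) {S : Finset (Fin n)}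
    (hS : ∀ u ∈ A, K ≤ (supp (f u)).card → ∃ z ∈ S, f u z ≠ ⊤) :
    HasBunches Z (listGraph A S f) t M A S := by
  intro u hu v hv huv d hd hdM
  have hu' : u ∈ A \ S := by simpa using hu
  have hvA : Z.distIn A t u v = Z.hopDist t u v := if_pos hv
  have hvM : Z.distIn A t u v ≤ M := hvA ▸ le_trans hd hdM
  have hlen : ∀ w, u ≠ w → w ∈ bunch (f u) S → (listGraph A S f).len u w ≤ f u w := by
    intro w huw hw
    simp only [listGraph, if_neg huw]
    exact (min_le_left _ _).trans (if_pos ⟨hu', hw⟩).le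
  suffices H : f u v ≤ ENNReal.ofReal d ∧ v ∈ bunch (f u) S ∨
      ∃ z ∈ S, f u z ≤ ENNReal.ofReal d from by
    rcases H with ⟨h1, h2⟩ | ⟨z, hz, h1⟩
    · exact .inl ((hlen v huv h2).trans h1)
    · right
      obtain ⟨w, hwS, hw, hwz⟩ := exists_mem_bunch hz (ne_top_of_le_ne_top ENNReal.ofReal_ne_top h1)
      refine ⟨w, hwS, (hlen w (fun e => hu.2 (e ▸ hwS)) hw).trans (hwz.trans (h1.trans ?_))⟩
      rw [ENNReal.ofReal_mul (by norm_num), ENNReal.ofReal_ofNat, two_mul]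
      exact le_self_add
  by_cases hr : rank (Z.distIn A t u) v < K
  · have hfv : f u v ≤ ENNReal.ofReal d := by rw [h.eq_distIn u v hvM hr, hvA]; exact hd
    by_cases hb : ∀ z ∈ S, ¬ Before (f u) z v
    · exact .inl ⟨hfv, mem_bunch.2 ⟨ne_top_of_le_ne_top ENNReal.ofReal_ne_top hfv, hb⟩⟩
    · push Not at hb
      obtain ⟨z, hz, hzv⟩ := hb
      exact .inr ⟨z, hz, hzv.le.trans hfv⟩
  · right
    -- The `K` vertices of `T` are all nearer than `v` or tied with it, so they are in the list; as
    -- the list has at most `K` entries, it is exactly `T`.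
    set T := Finset.univ.filter fun w => rank (Z.distIn A t u) w < K with hT
    have hTf : ∀ w ∈ T, f u w = Z.distIn A t u w ∧ f u w ≤ Z.distIn A t u v := by
      intro w hw
      have hw' : rank (Z.distIn A t u) w < K := by simpa [hT] using hw
      have hle := (before_of_rank_lt (hw'.trans_le (not_lt.1 hr))).le
      have := h.eq_distIn u w (hle.trans hvM) hw'
      exact ⟨this, this ▸ hle⟩
    have hTs : T ⊆ supp (f u) := fun w hw =>
      mem_supp.2 (ne_top_of_le_ne_top hM ((hTf w hw).2.trans hvM))
    have hTK : K ≤ T.card := le_card_rank_lt _ (not_lt.1 hr)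
    have hTe : T = supp (f u) := Finset.eq_of_subset_of_card_le hTs ((h.card_supp u).trans hTK)
    obtain ⟨z, hz, hzf⟩ := hS u hu.1 (hTK.trans (Finset.card_le_card hTs))
    exact ⟨z, hz, (hTf z (hTe ▸ mem_supp.2 hzf)).2.trans (hvA ▸ hd)⟩

theorem size_union_le (G H : WGraph (Fin n)) : (G ∪ H).size ≤ G.size + H.size := by
  unfold size
  refine (Set.ncard_le_ncard (fun e he => ?_) (Set.toFinite _)).trans (Set.ncard_union_le _ _)
  induction e using Sym2.ind with
  | _ u v =>
    simp only [SimpleGraph.mem_edgeSet, Set.mem_union, graph] at he ⊢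
    by_contra h
    push Not at h
    exact he (by rw [union_len, h.1, h.2, min_self])

theorem size_empty : (∅ : WGraph (Fin n)).size = 0 := by
  unfold size
  rw [Set.ncard_eq_zero (Set.toFinite _), Set.eq_empty_iff_forall_notMem]
  intro e
  induction e using Sym2.ind with
  | _ u v => simp [graph, empty_len]

theorem size_listGraph_le (A S : Finset (Fin n)) (f : Fin n → Fin n → ℝ≥0∞) :
    (listGraph A S f).size ≤ ∑ u ∈ A, (bunch (f u) S).card := by
  classical
  rw [← Finset.card_sigma]
  unfold size
  rw [← Set.ncard_coe_finset]
  refine (Set.ncard_le_ncard (t := (fun p : (_ : Fin n) × Fin n => s(p.1, p.2)) ''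
    (A.sigma fun u => bunch (f u) S : Finset ((_ : Fin n) × Fin n))) (fun e he => ?_)
    (Set.toFinite _)).trans (Set.ncard_image_le (Set.toFinite _))
  induction e using Sym2.ind with
  | _ u v =>
    simp only [SimpleGraph.mem_edgeSet, graph, listGraph] at he
    simp only [Set.mem_image, Finset.mem_coe, Finset.mem_sigma, Sigma.exists]
    by_cases h1 : u ∈ A \ S ∧ v ∈ bunch (f u) S
    · exact ⟨u, v, ⟨(Finset.mem_sdiff.1 h1.1).1, h1.2⟩, rfl⟩
    · by_cases h2 : v ∈ A \ S ∧ u ∈ bunch (f v) S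
      · exact ⟨v, u, ⟨(Finset.mem_sdiff.1 h2.1).1, h2.2⟩, Sym2.eq_swap⟩
      · rw [if_neg h1, if_neg h2] at he
        simp at he

end Lists

end WGraph

/-! ### Broadcast programs -/

/-- A program for the vertices `0, …, n - 1`. In the instruction `bcast F cont`, every vertex `v`
broadcasts the finite values of the list `F v z`, where `z` are the weights of the edges at `v`, and
then all continue with `cont f`, where `f` are the lists that were broadcast. -/
inductive BProg (n : ℕ) (α : Type) : Type
  | pure (a : α) : BProg n α
  | bcast (F : Fin n → (Fin n → ℝ≥0∞) → Fin n → ℝ≥0∞)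
      (cont : (Fin n → Fin n → ℝ≥0∞) → BProg n α) : BProg n α

namespace BProg

variable {n : ℕ} {α β : Type}

/-- One program after another. -/
def bind : BProg n α → (α → BProg n β) → BProg n β
  | pure a, g => g a
  | bcast F cont, g => bcast F fun f => bind (cont f) g

/-- Broadcast once and return the lists. -/
def ask (F : Fin n → (Fin n → ℝ≥0∞) → Fin n → ℝ≥0∞) : BProg n (Fin n → Fin n → ℝ≥0∞) :=
  bcast F pure

/-- Repeat a program `m` times, starting from `a`. -/
def iter (step : ℕ → α → BProg n α) : ℕ → α → BProg n α
  | 0, a => pure a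
  | m + 1, a => bind (iter step m a) (step m)

/-- The vertex `v` may broadcast the list `f`: there are at most `K` values, which are bounded and
sums of at most three weights of edges at `v` or numbers in `S`. -/
def ListOk (G : WGraph (Fin n)) (K : ℕ) (S : Set ℝ≥0∞) (v : Fin n) (f : Fin n → ℝ≥0∞) : Prop :=
  (WGraph.supp f).card ≤ K ∧ ∀ w, f w = ⊤ ∨ (f w ≤ (n : ℝ≥0∞) ^ 3 * G.maxLen ∧
    ∃ s : Multiset ℝ≥0∞, s.card ≤ 3 ∧ (∀ x ∈ s, x ∈ S ∨ ∃ u, x = G.len v u) ∧ s.sum = f w)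

/-- The weakest precondition: if the numbers `S` were broadcast in the first `m` steps, then the
program broadcasts only permitted lists, and its result `a`, the numbers `S'` that were broadcast in
the end, and the number of steps `m'` satisfy `Q a S' m'`. -/
def wp (G : WGraph (Fin n)) (K : ℕ) :
    BProg n α → Set ℝ≥0∞ → ℕ → (α → Set ℝ≥0∞ → ℕ → Prop) → Prop
  | pure a, S, m, Q => Q a S m
  | bcast F cont, S, m, Q => (∀ v, ListOk G K S v (F v (G.len v))) ∧
      wp G K (cont fun v => F v (G.len v))
        (S ∪ {x | x ≠ ⊤ ∧ ∃ v w, x = F v (G.len v) w}) (m + 1) Q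

theorem wp_mono {G : WGraph (Fin n)} {K : ℕ} {P : BProg n α} {S : Set ℝ≥0∞} {m : ℕ}
    {Q Q' : α → Set ℝ≥0∞ → ℕ → Prop} (h : wp G K P S m Q) (hQ : ∀ a S m, Q a S m → Q' a S m) :
    wp G K P S m Q' := by
  induction P generalizing S m with
  | pure a => exact hQ _ _ _ h
  | bcast F cont ih => exact ⟨h.1, ih _ h.2⟩

theorem wp_bind {G : WGraph (Fin n)} {K : ℕ} {P : BProg n α} {g : α → BProg n β} {S : Set ℝ≥0∞}
    {m : ℕ} {Q : β → Set ℝ≥0∞ → ℕ → Prop} (h : wp G K P S m fun a S' m' => wp G K (g a) S' m' Q) :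
    wp G K (bind P g) S m Q := by
  induction P generalizing S m with
  | pure a => exact h
  | bcast F cont ih => exact ⟨h.1, ih _ h.2⟩

theorem wp_iter {G : WGraph (Fin n)} {K : ℕ} {step : ℕ → α → BProg n α}
    {I : ℕ → α → Set ℝ≥0∞ → ℕ → Prop} (N : ℕ) {a : α} {S : Set ℝ≥0∞} {m : ℕ} (h0 : I 0 a S m)
    (hstep : ∀ i < N, ∀ a S m, I i a S m → wp G K (step i a) S m (I (i + 1))) :
    wp G K (iter step N a) S m (I N) := by
  induction N with
  | zero => exact h0
  | succ N ih =>
    exact wp_bind (wp_mono (ih fun i hi => hstep i (by omega)) (hstep N (by omega)))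

/-! ### Simulation in the Congested Clique -/

/-- The state of a vertex: its name, the weights of its edges, the rest of the program, and the
messages received since the last instruction. -/
structure VState (n : ℕ) (α : Type) where
  name : Fin n
  edges : Fin n → ℝ≥0∞
  prog : BProg n α
  buffer : List (Fin n → CliqueMsg n 3)

/-- The message that carries no number. -/
def idle (hn : 0 < n) : CliqueMsg n 3 := ⟨⟨0, by positivity⟩, fun _ => ⊤⟩

/-- The message that carries the value `x` of the vertex `w`. -/
def entry (w : Fin n) (x : ℝ≥0∞) : CliqueMsg n 3 :=
  ⟨⟨w, w.2.trans_le (Nat.le_self_pow (by norm_num) n)⟩, fun _ => x⟩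

/-- The `j`-th message for the list `f`. -/
noncomputable def listMsg (hn : 0 < n) (f : Fin n → ℝ≥0∞) (j : ℕ) : CliqueMsg n 3 :=
  match (WGraph.supp f).toList[j]? with
  | none => idle hn
  | some w => entry w (f w)

theorem listMsg_cases (hn : 0 < n) (f : Fin n → ℝ≥0∞) (j : ℕ) :
    listMsg hn f j = idle hn ∨ ∃ w, listMsg hn f j = entry w (f w) := by
  unfold listMsg
  cases (WGraph.supp f).toList[j]? with
  | none => exact .inl rfl
  | some w => exact .inr ⟨w, rfl⟩

open Classical in
/-- The lists in the messages. -/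
noncomputable def decode (l : List (Fin n → CliqueMsg n 3)) (u w : Fin n) : ℝ≥0∞ :=
  ⨅ msg ∈ l, if ((msg u).word : ℕ) = w then (msg u).val 0 else ⊤

/-- Idle messages name the vertex `0`, but with the value `⊤`, which does not affect the infimum. -/
theorem decode_listMsg (hn : 0 < n) (f : Fin n → Fin n → ℝ≥0∞) {K : ℕ}
    (hK : ∀ v, (WGraph.supp (f v)).card ≤ K) :
    decode ((List.range K).map fun j v => listMsg hn (f v) j) = f := by
  funext u w
  unfold decode
  apply le_antisymm
  · by_cases hw : f u w = ⊤
    · rw [hw]; exact le_top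
    · obtain ⟨j, hj, hjw⟩ := List.mem_iff_getElem.1
        (Finset.mem_toList.2 (WGraph.mem_supp.2 hw))
      have hjK : j < K := by
        rw [Finset.length_toList] at hj
        exact hj.trans_le (hK u)
      refine (iInf₂_le _ (List.mem_map.2 ⟨j, List.mem_range.2 hjK, rfl⟩)).trans ?_
      simp [listMsg, List.getElem?_eq_getElem hj, hjw, entry]
  · refine le_iInf₂ fun msg hmsg => ?_
    obtain ⟨j, -, rfl⟩ := List.mem_map.1 hmsg
    beta_reduce
    split_ifs with h'
    · rcases listMsg_cases hn (f u) j with h | ⟨w', h⟩ <;> rw [h] at h' ⊢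
      · exact le_top
      · have : w' = w := Fin.ext h'
        subst this
        exact le_rfl
    · exact le_top

/-- Execution of a program in the Congested Clique, with `K` rounds for each broadcast. -/
noncomputable def toAlg (hn : 0 < n) (K : ℕ) (P : BProg n (WGraph (Fin n))) : CliqueAlg n 3 where
  State := VState n (WGraph (Fin n))
  coins := 0
  start v z _ := ⟨v, z, P, []⟩
  send s _ := match s.prog with
    | pure _ => idle hn
    | bcast F _ => listMsg hn (F s.name s.edges) s.buffer.length
  recv s msg := match s.prog with
    | pure _ => s
    | bcast _ cont =>
      if s.buffer.length + 1 = K then ⟨s.name, s.edges, cont (decode (s.buffer ++ [msg])), []⟩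
      else ⟨s.name, s.edges, s.prog, s.buffer ++ [msg]⟩
  out s := match s.prog with
    | pure H => some (H.len s.name)
    | bcast _ _ => none

section Simulation

variable {hn : 0 < n} {K : ℕ} {P₀ : BProg n (WGraph (Fin n))} {G : WGraph (Fin n)}
  {ω : (toAlg hn K P₀).Seed}

/-- The length of the buffer is the round counter within a broadcast; it is the same everywhere, so
the vertices stay synchronized. -/
theorem run_bcast {F : Fin n → (Fin n → ℝ≥0∞) → Fin n → ℝ≥0∞}
    {cont : (Fin n → Fin n → ℝ≥0∞) → BProg n (WGraph (Fin n))} {r : ℕ}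
    (h : ∀ v, (toAlg hn K P₀).run G ω r v = ⟨v, G.len v, bcast F cont, []⟩) {j : ℕ} (hj : j < K)
    (v : Fin n) : (toAlg hn K P₀).run G ω (r + j) v =
      ⟨v, G.len v, bcast F cont,
        (List.range j).map fun i v => listMsg hn (F v (G.len v)) i⟩ := by
  induction j generalizing v with
  | zero => simpa using h v
  | succ j ih =>
    have ih' := ih (by omega)
    change (toAlg hn K P₀).recv ((toAlg hn K P₀).run G ω (r + j) v)
      (fun u => (toAlg hn K P₀).send ((toAlg hn K P₀).run G ω (r + j) u) v) = _
    simp only [ih']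
    simp only [toAlg, List.length_map, List.length_range]
    rw [if_neg (by omega), List.range_succ, List.map_append]
    rfl

theorem run_bcast_end {F : Fin n → (Fin n → ℝ≥0∞) → Fin n → ℝ≥0∞}
    {cont : (Fin n → Fin n → ℝ≥0∞) → BProg n (WGraph (Fin n))} {r : ℕ}
    (h : ∀ v, (toAlg hn K P₀).run G ω r v = ⟨v, G.len v, bcast F cont, []⟩) (hK : 1 ≤ K)
    (hF : ∀ v, (WGraph.supp (F v (G.len v))).card ≤ K) (v : Fin n) :
    (toAlg hn K P₀).run G ω (r + K) v = ⟨v, G.len v, cont fun v => F v (G.len v), []⟩ := by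
  obtain ⟨j, rfl⟩ : ∃ j, K = j + 1 := ⟨K - 1, by omega⟩
  have ih' := run_bcast h (Nat.lt_succ_self j)
  change (toAlg hn (j + 1) P₀).recv ((toAlg hn (j + 1) P₀).run G ω (r + j) v)
    (fun u => (toAlg hn (j + 1) P₀).send ((toAlg hn (j + 1) P₀).run G ω (r + j) u) v) = _
  simp only [ih']
  simp only [toAlg, List.length_map, List.length_range, if_true]
  rw [← decode_listMsg hn (fun v => F v (G.len v)) hF, List.range_succ, List.map_append]
  rfl

theorem run_pure {a : WGraph (Fin n)} {r : ℕ}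
    (h : ∀ v, (toAlg hn K P₀).run G ω r v = ⟨v, G.len v, pure a, []⟩) (j : ℕ) (v : Fin n) :
    (toAlg hn K P₀).run G ω (r + j) v = ⟨v, G.len v, pure a, []⟩ := by
  induction j with
  | zero => exact h v
  | succ j ih =>
    change (toAlg hn K P₀).recv ((toAlg hn K P₀).run G ω (r + j) v) _ = _
    rw [ih]
    rfl

/-- The restriction on the messages that `v` sends in the round `r`. -/
def MsgOk (A : CliqueAlg n 3) (G : WGraph (Fin n)) (ω : A.Seed) (r : ℕ) (v : Fin n) : Prop :=
  ∀ (u : Fin n) (j : Fin 3), (A.send (A.run G ω r v) u).val j = ⊤ ∨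
    ((A.send (A.run G ω r v) u).val j ≤ (n : ℝ≥0∞) ^ 3 * G.maxLen ∧
      ∃ s : Multiset ℝ≥0∞, s.card ≤ 3 ∧ (∀ x ∈ s, x ∈ A.known G ω r v) ∧
        s.sum = (A.send (A.run G ω r v) u).val j)

theorem known_mono (A : CliqueAlg n 3) (ω : A.Seed) {r r' : ℕ} (h : r ≤ r') (v : Fin n) :
    A.known G ω r v ⊆ A.known G ω r' v := by
  rintro x (hx | ⟨s, hs, hx⟩)
  · exact .inl hx
  · exact .inr ⟨s, hs.trans_le h, hx⟩

/-- Induction on the program. The hypothesis on `S` turns "was broadcast" into "is known to every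
vertex". The messages of all later rounds are covered, since the bandwidth restriction also applies
after the program has ended, when only idle messages are sent. -/
theorem simulation (hK : 1 ≤ K) (P : BProg n (WGraph (Fin n))) {r m : ℕ} {S : Set ℝ≥0∞}
    {Q : WGraph (Fin n) → Set ℝ≥0∞ → ℕ → Prop} (hP : wp G K P S m Q)
    (hr : ∀ v, (toAlg hn K P₀).run G ω r v = ⟨v, G.len v, P, []⟩)
    (hS : ∀ v, S ⊆ (toAlg hn K P₀).known G ω r v) :
    (∀ r' ≥ r, ∀ v, MsgOk (toAlg hn K P₀) G ω r' v) ∧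
      ∃ H S' m', Q H S' m' ∧ m ≤ m' ∧ ∀ r' ≥ r + K * (m' - m), ∀ v,
        (toAlg hn K P₀).run G ω r' v = ⟨v, G.len v, pure H, []⟩ := by
  induction P generalizing r m S with
  | pure a =>
    refine ⟨fun r' hr' v u j => ?_, a, S, m, hP, le_rfl, fun r' hr' v => ?_⟩
    · obtain ⟨i, rfl⟩ := Nat.exists_eq_add_of_le hr'
      rw [run_pure hr i v]
      exact .inl rfl
    · obtain ⟨i, rfl⟩ := Nat.exists_eq_add_of_le hr'
      rw [add_assoc]
      exact run_pure hr _ v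
  | bcast F cont ih =>
    obtain ⟨hF, hcont⟩ := hP
    have hend := run_bcast_end hr hK fun v => (hF v).1
    have hS' : ∀ v, S ∪ {x | x ≠ ⊤ ∧ ∃ v w, x = F v (G.len v) w} ⊆
        (toAlg hn K P₀).known G ω (r + K) v := by
      rintro v x (hx | ⟨hx, u, w, rfl⟩)
      · exact known_mono _ ω (by omega) v (hS v hx)
      · right
        obtain ⟨j, hj, hjw⟩ := List.mem_iff_getElem.1
          (Finset.mem_toList.2 (WGraph.mem_supp.2 hx))
        have hjK : j < K := by
          rw [Finset.length_toList] at hj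
          exact hj.trans_le (hF u).1
        refine ⟨r + j, by omega, u, 0, ?_⟩
        rw [run_bcast hr hjK u]
        simp [toAlg, listMsg, List.getElem?_eq_getElem hj, hjw, entry]
    obtain ⟨h1, H, S₁, m₁, hQ, hm, h2⟩ := ih _ hcont hend hS'
    refine ⟨fun r' hr' v => ?_, H, S₁, m₁, hQ, by omega, fun r' hr' v => h2 r' ?_ v⟩
    · by_cases hrK : r + K ≤ r'
      · exact h1 r' hrK v
      · obtain ⟨j, rfl⟩ := Nat.exists_eq_add_of_le hr'
        intro u i
        rw [run_bcast hr (by omega) v]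
        simp only [toAlg, List.length_map, List.length_range]
        rcases listMsg_cases hn (F v (G.len v)) j with hj | ⟨w, hj⟩ <;> rw [hj]
        · exact .inl rfl
        · refine ((hF v).2 w).imp id fun ⟨h3, s, hs, hs', hsum⟩ => ⟨h3, s, hs, fun x hx => ?_, hsum⟩
          rcases hs' x hx with h4 | h4
          · exact known_mono (toAlg hn K P₀) ω hr' v (hS v h4)
          · exact .inl h4
    · obtain ⟨d, rfl⟩ := Nat.exists_eq_add_of_le hm
      rw [show m + 1 + d - (m + 1) = d by omega]
      rw [show m + 1 + d - m = d + 1 by omega, Nat.mul_succ] at hr'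
      omega

end Simulation

/-- The program uses no coins and succeeds for every seed, so the failure probability is `0 ≤ q`. -/
theorem computesHopset {K : ℕ} (hn : 0 < n) (hK : 1 ≤ K) (P : BProg n (WGraph (Fin n)))
    {N β : ℕ} {ε S q : ℝ} (hq : 0 ≤ q)
    (hP : ∀ G : WGraph (Fin n), G.Positive →
      wp G K P ∅ 0 fun H _ m => m ≤ N ∧ G.IsHopset H β ε ∧ (H.size : ℝ) ≤ S) :
    (toAlg hn K P).ComputesHopset (K * N) β ε S q := by
  refine ⟨fun G hG ω r v u j => ?_, fun G hG => ?_⟩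
  · exact (simulation hK P (hP G hG) (ω := ω) (r := 0) (fun v => rfl)
      (fun v => Set.empty_subset _)).1 r (Nat.zero_le _) v u j
  · have key : ∀ ω : (toAlg hn K P).Seed, ∃ H, (toAlg hn K P).Outputs G ω (K * N) H ∧
        G.IsHopset H β ε ∧ (H.size : ℝ) ≤ S := by
      intro ω
      obtain ⟨-, H, -, m, ⟨hm, hH⟩, -, hrun⟩ := simulation hK P (hP G hG) (ω := ω) (r := 0)
        (fun v => rfl) (fun v => Set.empty_subset _)
      refine ⟨H, fun v => ?_, hH⟩
      rw [hrun (K * N) (by rw [zero_add, Nat.sub_zero]; exact Nat.mul_le_mul_left K hm) v]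
      rfl
    classical
    refine ⟨fun ω => .inl (key ω), ?_⟩
    rw [Finset.filter_true_of_mem fun ω _ => (key ω).imp fun H h => h.1, Finset.card_univ]
    have : (0 : ℝ) ≤ Fintype.card (toAlg hn K P).Seed := Nat.cast_nonneg _
    nlinarith

end BProg

/-! ### The hopset program. -/

namespace BProg

open WGraph

variable {n : ℕ}

/-- The list that `v` broadcasts to extend the lists `f` by one edge of `G ∪ H' ∪ H`. -/
noncomputable def exploreList (K : ℕ) (M : ℝ≥0∞) (H' H : WGraph (Fin n)) (A : Finset (Fin n))
    (f : Fin n → Fin n → ℝ≥0∞) (v : Fin n) (z : Fin n → ℝ≥0∞) : Fin n → ℝ≥0∞ :=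
  extend A K M f (fun x => min (min (z x) (H'.len v x)) (H.len v x)) v

/-- Compute the `K` nearest vertices of `A`, with `E` edges of `G ∪ H' ∪ H`. -/
noncomputable def explore (K E : ℕ) (M : ℝ≥0∞) (H' H : WGraph (Fin n)) (A : Finset (Fin n)) :
    BProg n (Fin n → Fin n → ℝ≥0∞) :=
  iter (fun _ f => ask (exploreList K M H' H A f)) E (source A)

/-- A good choice of the next vertex set. -/
def IsSample (K b : ℕ) (A : Finset (Fin n)) (f : Fin n → Fin n → ℝ≥0∞) (S : Finset (Fin n)) :
    Prop :=
  S.card * (2 * b) ≤ A.card ∧ ∑ u ∈ A, (bunch (f u) S).card ≤ 16 * (A.card * b) ∧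
    ∀ u ∈ A, K ≤ (supp (f u)).card → ∃ z ∈ S, f u z ≠ ⊤

/-- The next vertex set, which all vertices compute from the lists. -/
noncomputable def sample (K b : ℕ) (A : Finset (Fin n)) (f : Fin n → Fin n → ℝ≥0∞) :
    Finset (Fin n) := Classical.epsilon (IsSample K b A f)

/-- One vertex set: add the edges to the bunches. -/
noncomputable def level (K E : ℕ) (M : ℝ≥0∞) (b : ℕ → ℕ) (H' : WGraph (Fin n)) (i : ℕ)
    (p : WGraph (Fin n) × Finset (Fin n)) : BProg n (WGraph (Fin n) × Finset (Fin n)) :=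
  bind (explore K E M H' p.1 p.2) fun f =>
    pure (p.1 ∪ listGraph p.2 (sample K (b i) p.2 f) f, sample K (b i) p.2 f)

/-- One hop scale. -/
noncomputable def scale (K E k : ℕ) (M : ℝ≥0∞) (b : ℕ → ℕ) (H' : WGraph (Fin n)) :
    BProg n (WGraph (Fin n)) :=
  bind (iter (level K E M b H') (k + 1) (∅, Finset.univ)) fun p => pure p.1

open Classical in
/-- The largest weight of an edge at `v`. -/
noncomputable def maxList (v : Fin n) (z : Fin n → ℝ≥0∞) (w : Fin n) : ℝ≥0∞ :=
  if w = v then ⨆ (u) (_ : z u ≠ ⊤), z u else ⊤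

/-- The program that computes a hopset with `s` hop scales. -/
noncomputable def hopsetProg (n K E k s : ℕ) (b : ℕ → ℕ) : BProg n (WGraph (Fin n)) :=
  bind (ask maxList) fun f =>
    iter (fun _ H' => scale K E k ((n : ℝ≥0∞) ^ 3 * ⨆ v, f v v) b H') s ∅

/-! ### Analysis of the program -/

theorem maxLen_ne_top (G : WGraph (Fin n)) : G.maxLen ≠ ⊤ := by
  classical
  have h : G.maxLen ≤ ∑ u, ∑ v, if G.len u v = ⊤ then 0 else G.len u v := by
    refine iSup_le fun u => iSup_le fun v => iSup_le fun huv => ?_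
    have h1 := Finset.single_le_sum (f := fun v => if G.len u v = ⊤ then 0 else G.len u v)
      (fun _ _ => zero_le) (Finset.mem_univ v)
    have h2 := Finset.single_le_sum
      (f := fun u => ∑ v, if G.len u v = ⊤ then 0 else G.len u v)
      (fun _ _ => zero_le) (Finset.mem_univ u)
    refine le_trans ?_ (h1.trans h2)
    simp [huv]
  refine ne_top_of_le_ne_top (ENNReal.sum_ne_top.2 fun u _ => ENNReal.sum_ne_top.2 fun v _ => ?_) h
  split_ifs with h
  · exact ENNReal.zero_ne_top
  · exact h

theorem maxBound_ne_top (G : WGraph (Fin n)) : (n : ℝ≥0∞) ^ 3 * G.maxLen ≠ ⊤ :=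
  ENNReal.mul_ne_top (ENNReal.pow_ne_top (ENNReal.natCast_ne_top n)) (maxLen_ne_top G)

/-- All weights of `H` were broadcast. -/
def Known (H : WGraph (Fin n)) (S : Set ℝ≥0∞) : Prop :=
  ∀ u v, H.len u v = ⊤ ∨ H.len u v = 0 ∨ H.len u v ∈ S

theorem Known.mono {H : WGraph (Fin n)} {S S' : Set ℝ≥0∞} (h : Known H S) (hS : S ⊆ S') :
    Known H S' := fun u v => (h u v).imp id fun h => h.imp id fun h => hS h

theorem known_empty (S : Set ℝ≥0∞) : Known (∅ : WGraph (Fin n)) S := fun _ _ => .inl rfl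

theorem Known.union {H H' : WGraph (Fin n)} {S : Set ℝ≥0∞} (h : Known H S) (h' : Known H' S) :
    Known (H ∪ H') S := by
  intro u v
  rw [union_len]
  rcases min_choice (H.len u v) (H'.len u v) with e | e <;> rw [e]
  · exact h u v
  · exact h' u v

/-- `x` is a sum of at most `c` numbers that `v` knows. -/
def SumOf (G : WGraph (Fin n)) (S : Set ℝ≥0∞) (v : Fin n) (c : ℕ) (x : ℝ≥0∞) : Prop :=
  ∃ s : Multiset ℝ≥0∞, s.card ≤ c ∧ (∀ y ∈ s, y ∈ S ∨ ∃ u, y = G.len v u) ∧ s.sum = x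

theorem sumOf_zero (G : WGraph (Fin n)) (S : Set ℝ≥0∞) (v : Fin n) (c : ℕ) : SumOf G S v c 0 :=
  ⟨0, by simp⟩

theorem sumOf_of_mem {G : WGraph (Fin n)} {S : Set ℝ≥0∞} {v : Fin n} {x : ℝ≥0∞}
    (h : x ∈ S ∨ ∃ u, x = G.len v u) : SumOf G S v 1 x := ⟨{x}, by simpa using h⟩

theorem SumOf.add {G : WGraph (Fin n)} {S : Set ℝ≥0∞} {v : Fin n} {c c' : ℕ} {x x' : ℝ≥0∞}
    (h : SumOf G S v c x) (h' : SumOf G S v c' x') : SumOf G S v (c + c') (x + x') := by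
  obtain ⟨s, hs, hs1, rfl⟩ := h
  obtain ⟨s', hs', hs1', rfl⟩ := h'
  refine ⟨s + s', by rw [Multiset.card_add]; omega, fun y hy => ?_, Multiset.sum_add _ _⟩
  rcases Multiset.mem_add.1 hy with h | h
  exacts [hs1 y h, hs1' y h]

theorem SumOf.mono {G : WGraph (Fin n)} {S : Set ℝ≥0∞} {v : Fin n} {c c' : ℕ} {x : ℝ≥0∞}
    (h : SumOf G S v c x) (hc : c ≤ c') : SumOf G S v c' x :=
  h.imp fun _ hs => ⟨hs.1.trans hc, hs.2⟩

/-- A finite entry is `0`, or an edge weight plus an old entry. Edges of `H'` and `H` carry weights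
that were broadcast before, so every nonzero summand is known to `v`; the cutoff of the lists
enforces the bound on the size of the numbers. -/
theorem exploreList_ok {G H' H : WGraph (Fin n)} {K : ℕ} {S : Set ℝ≥0∞} (hH' : Known H' S)
    (hH : Known H S) {A : Finset (Fin n)} {f : Fin n → Fin n → ℝ≥0∞}
    (hf : ∀ u w, f u w = ⊤ ∨ f u w = 0 ∨ f u w ∈ S) (v : Fin n) :
    ListOk G K S v (exploreList K ((n : ℝ≥0∞) ^ 3 * G.maxLen) H' H A f v (G.len v)) := by
  refine ⟨card_supp_truncate_le _ _ _, fun w => ?_⟩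
  unfold exploreList extend truncate
  split_ifs with h
  swap
  · exact .inl rfl
  refine .inr ⟨h.1, SumOf.mono (c := 2) ?_ (by norm_num)⟩
  have hfin := ne_top_of_le_ne_top (maxBound_ne_top G) h.1
  beta_reduce at hfin ⊢
  rcases min_choice (source A v w)
    (⨅ x, min (min (G.len v x) (H'.len v x)) (H.len v x) + f x w) with e | e <;> rw [e] at hfin ⊢
  · unfold source at hfin ⊢
    split_ifs with h0
    · exact sumOf_zero _ _ _ _
    · exact absurd (if_neg h0) hfin
  · have : Nonempty (Fin n) := ⟨v⟩
    obtain ⟨x, hx⟩ := exists_eq_ciInf_of_finite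
      (f := fun x => min (min (G.len v x) (H'.len v x)) (H.len v x) + f x w)
    rw [← hx] at hfin ⊢
    have hfin' := ENNReal.add_ne_top.1 hfin
    have hk : ∀ y : ℝ≥0∞, y ≠ ⊤ → (y = ⊤ ∨ y = 0 ∨ y ∈ S) → SumOf G S v 1 y := by
      rintro y hy (h1 | rfl | h1)
      · exact absurd h1 hy
      · exact sumOf_zero _ _ _ _
      · exact sumOf_of_mem (.inl h1)
    refine SumOf.add (c := 1) (c' := 1) ?_ (hk _ hfin'.2 (hf x w))
    have h1 := hfin'.1
    rcases min_choice (min (G.len v x) (H'.len v x)) (H.len v x) with e1 | e1 <;> rw [e1] at h1 ⊢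
    · rcases min_choice (G.len v x) (H'.len v x) with e2 | e2 <;> rw [e2] at h1 ⊢
      · exact sumOf_of_mem (.inr ⟨x, rfl⟩)
      · exact hk _ h1 (hH' v x)
    · exact hk _ h1 (hH v x)

theorem wp_explore {G H' H : WGraph (Fin n)} {K : ℕ} (hK : 1 ≤ K) (E : ℕ) {S : Set ℝ≥0∞}
    (hH' : Known H' S) (hH : Known H S) (A : Finset (Fin n)) (m : ℕ) :
    wp G K (explore K E ((n : ℝ≥0∞) ^ 3 * G.maxLen) H' H A) S m fun f S' m' =>
      IsLists (G ∪ H' ∪ H) A K ((n : ℝ≥0∞) ^ 3 * G.maxLen) E f ∧ S ⊆ S' ∧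
        (∀ u w, f u w = ⊤ ∨ f u w = 0 ∨ f u w ∈ S') ∧ m' = m + E := by
  refine wp_iter (I := fun j f S' m' =>
      IsLists (G ∪ H' ∪ H) A K ((n : ℝ≥0∞) ^ 3 * G.maxLen) j f ∧ S ⊆ S' ∧
        (∀ u w, f u w = ⊤ ∨ f u w = 0 ∨ f u w ∈ S') ∧ m' = m + j) E ?_ ?_
  · refine ⟨isLists_source _ A hK _, subset_rfl, fun u w => ?_, rfl⟩
    unfold source
    split_ifs <;> simp
  · rintro j - f S₁ m₁ ⟨hf, hS, hfk, rfl⟩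
    refine ⟨exploreList_ok (hH'.mono hS) (hH.mono hS) hfk, hf.extend (maxBound_ne_top G),
      hS.trans Set.subset_union_left, fun u w => ?_, rfl⟩
    by_cases h : exploreList K ((n : ℝ≥0∞) ^ 3 * G.maxLen) H' H A f u (G.len u) w = ⊤
    · exact .inl h
    · exact .inr (.inr (.inr ⟨h, u, w, rfl⟩))

/-- `exists_sample` shows that the choice operator has something to choose. The choice depends only
on data that all vertices share, so they all make the same one. -/
theorem isSample_sample {Z : WGraph (Fin n)} {A : Finset (Fin n)} {K b t : ℕ} {M : ℝ≥0∞}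
    {f : Fin n → Fin n → ℝ≥0∞} (hf : IsLists Z A K M t f) (hb : 1 ≤ b)
    (hK : 4 * b * (Nat.clog 2 n + 3) ≤ K) : IsSample K b A f (sample K b A f) := by
  have hA : A.card ≤ n := by simpa using Finset.card_le_univ A
  obtain ⟨S, -, hS⟩ := exists_sample A (f := f) (fun _ _ h => hf.mem_of_ne_top h) hb
    (sample_condition hb hA hK)
  exact Classical.epsilon_spec (p := IsSample K b A f) ⟨S, hS⟩

/-- The parameters of the program. -/
structure Params (n K E k s τ β : ℕ) (b : ℕ → ℕ) (ε δ : ℝ) : Prop where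
  two_le_n : 2 ≤ n
  two_le_k : 2 ≤ k
  two_le_τ : 2 ≤ τ
  ε_pos : 0 < ε
  mul_ε_le : s * ε ≤ 1 / 5
  δ_pos : 0 < δ
  δ_lt : δ < 1 / (15 * k)
  δ_le : 12 * δ * k ≤ ε
  β_eq : β = ⌊(3 / δ) ^ k⌋₊
  E_eq : E = 2 * (τ * β)
  one_le_b : ∀ i, 1 ≤ b i
  b_succ_le : ∀ i, b (i + 1) ≤ b i ^ 2
  le_K : ∀ i, 4 * b i * (Nat.clog 2 n + 3) ≤ K
  lt_prod : n < ∏ i ∈ Finset.range (k + 1), 2 * b i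
  le_pow : n ≤ τ ^ s

namespace Params

variable {K E k s τ β : ℕ} {b : ℕ → ℕ} {ε δ : ℝ} (hp : Params n K E k s τ β b ε δ)
include hp

theorem one_le_div : 1 ≤ 3 / δ := by
  have hk' : (2 : ℝ) ≤ k := by exact_mod_cast hp.two_le_k
  have hδk : δ * (15 * k) < 1 := by
    have := hp.δ_lt
    rwa [lt_div_iff₀ (by positivity)] at this
  have := hp.δ_pos
  rw [le_div_iff₀ hp.δ_pos]; nlinarith

theorem one_le_K : 1 ≤ K := by
  refine le_trans ?_ (hp.le_K 0)
  have := hp.one_le_b 0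
  exact Nat.one_le_iff_ne_zero.2 (by positivity)

/-- Distances are at most `n * maxLen` and `3 n ≤ n ^ 3`; so the cutoff discards nothing that the
stretch induction needs. -/
theorem le_maxBound {G : WGraph (Fin n)} {L : ℕ} {x y : Fin n} {r : ℝ} (h : G.Shortest L x y r) :
    ENNReal.ofReal (3 * r) ≤ (n : ℝ≥0∞) ^ 3 * G.maxLen := by
  have h1 := G.dist_le_maxLen x y (by rw [h.dist_eq]; exact ENNReal.ofReal_ne_top)
  rw [h.dist_eq, Fintype.card_fin] at h1
  have h3 : 3 * n ≤ n ^ 3 := by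
    have := hp.two_le_n
    nlinarith [Nat.mul_le_mul this this]
  calc ENNReal.ofReal (3 * r) = 3 * ENNReal.ofReal r := by
        rw [ENNReal.ofReal_mul (by norm_num)]; simp
    _ ≤ 3 * (n * G.maxLen) := by gcongr
    _ = ((3 * n : ℕ) : ℝ≥0∞) * G.maxLen := by push_cast; ring
    _ ≤ ((n ^ 3 : ℕ) : ℝ≥0∞) * G.maxLen := by gcongr
    _ = _ := by push_cast; rfl

/-- The invariant of one hop scale, before the vertex set with the index `i`. -/
structure Inv (G H' : WGraph (Fin n)) (L : ℕ) (σ δ : ℝ) (b : ℕ → ℕ) (i : ℕ)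
    (p : WGraph (Fin n) × Finset (Fin n)) (S : Set ℝ≥0∞) : Prop where
  known' : Known H' S
  known : Known p.1 S
  dist_le : ∀ u v, G.dist u v ≤ p.1.len u v
  first : i = 0 → p.2 = Finset.univ
  approx : ∀ j, i = j + 1 →
    ApproxUnless G (G ∪ p.1) L ⌊(3 / δ) ^ j⌋₊ (σ * (1 + 12 * δ * j)) (p.2 : Set (Fin n))
  card_le : p.2.card * ∏ j ∈ Finset.range i, 2 * b j ≤ n
  size_le : p.1.size + 32 * (p.2.card * b i) ≤ 32 * (n * b 0)

theorem wp_level {G H' : WGraph (Fin n)} (hG : G.Positive) {L : ℕ} {σ : ℝ} (hσ : 1 ≤ σ)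
    (hσ' : σ ≤ 5 / 4) (hH' : G.IsHopsetUpTo H' β (σ - 1) L) {i : ℕ} (hi : i < k + 1)
    {p : WGraph (Fin n) × Finset (Fin n)} {S : Set ℝ≥0∞}
    (h : Inv G H' (τ * L) σ δ b i p S) (m : ℕ) :
    wp G K (level K E ((n : ℝ≥0∞) ^ 3 * G.maxLen) b H' i p) S m fun p' S' m' =>
      Inv G H' (τ * L) σ δ b (i + 1) p' S' ∧ m' = m + E := by
  refine wp_bind (wp_mono (wp_explore hp.one_le_K E h.known' h.known p.2 m) ?_)
  rintro f S' m' ⟨hf, hS, hfk, rfl⟩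
  refine ⟨?_, rfl⟩
  obtain ⟨H, A⟩ := p
  dsimp only at hf hS hfk ⊢
  obtain ⟨hT1, hT2, hT3⟩ := isSample_sample hf (hp.one_le_b i) (hp.le_K i)
  set T := sample K (b i) A f
  have hZ : ∀ x y r, G.Shortest (τ * L) x y r → (G ∪ H' ∪ H).Reaches (τ * β) x y (σ * r) :=
    fun x y r hr => (Shortest.reaches_mul (by linarith)
      (fun x y r h => hH'.reaches (by linarith) h) τ hr).mono_len fun u v => min_le_left _ _
  have hB : HasBunches (G ∪ H' ∪ H) (H ∪ listGraph A T f) E ((n : ℝ≥0∞) ^ 3 * G.maxLen) A T :=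
    (hf.hasBunches (maxBound_ne_top G) hT3).mono_len fun u v => min_le_right _ _
  -- `τ β` hops replace a path of `τ L` edges and `2 β` hops suffice for the side trips; `2 ≤ τ`
  -- makes room for both in `2 τ β`.
  have hβ : τ * β + 2 * β ≤ E := by
    rw [hp.E_eq]
    nlinarith [Nat.mul_le_mul_right β hp.two_le_τ]
  refine ⟨h.known'.mono hS, (h.known.mono hS).union fun u v => ?_,
    G.dist_le_union_len h.dist_le (dist_le_listGraph_len (G.dist_le_union_len
      (G.dist_le_union_len G.dist_le_len hH'.1) h.dist_le) hf T), fun h => by omega, ?_, ?_, ?_⟩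
  · rcases listGraph_len_mem A T f u v with e | e | e <;> rw [e]
    · exact .inl rfl
    · exact hfk u v
    · exact hfk v u
  · intro j hj
    obtain rfl : i = j := by omega
    cases i with
    | zero =>
      have hA : A = Finset.univ := h.first rfl
      subst hA
      have := approxUnless_first (h := ⌊(3 / δ) ^ 0⌋₊) hσ' hZ (fun x y r => hp.le_maxBound)
        (by simpa using hB) (by omega) (by simp)
      simpa using this
    | succ j =>
      refine (h.approx j rfl).next_level hG hσ hσ' hp.δ_pos hp.δ_lt hp.two_le_k (by omega) hZ ?_ ?_
        (fun x y r => hp.le_maxBound) hB ?_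
      · exact fun u v => min_le_min (min_le_left _ _) le_rfl
      · exact fun u v => min_le_left _ _
      · have : ⌊(3 / δ) ^ j⌋₊ ≤ β := by
          rw [hp.β_eq]
          exact Nat.floor_le_floor (pow_le_pow_right₀ hp.one_le_div (by omega))
        omega
  · rw [Finset.prod_range_succ]
    calc _ = (T.card * (2 * b i)) * ∏ j ∈ Finset.range i, 2 * b j := by ring
      _ ≤ A.card * ∏ j ∈ Finset.range i, 2 * b j := Nat.mul_le_mul_right _ hT1
      _ ≤ n := h.card_le
  -- The level adds at most `16 |A| b_i` edges, and `32 |T| b_{i+1} ≤ 32 |T| b_i ^ 2 ≤ 16 |A| b_i`.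
  -- So the old term `32 |A| b_i` pays for both.
  · have h1 := size_union_le H (listGraph A T f)
    have h2 := size_listGraph_le A T f
    have h3 : T.card * b (i + 1) ≤ T.card * b i ^ 2 := Nat.mul_le_mul_left _ (hp.b_succ_le i)
    have h4 : T.card * (2 * b i) * b i ≤ A.card * b i := Nat.mul_le_mul_right _ hT1
    have h5 : T.card * (2 * b i) * b i = 2 * (T.card * b i ^ 2) := by ring
    have h6 := h.size_le
    dsimp only at h6 ⊢
    omega

/-- Every scale starts from the empty graph, so the sizes of different scales do not add up. The
cardinality invariant and `lt_prod` leave no vertex in the last set. -/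
theorem wp_scale {G H' : WGraph (Fin n)} (hG : G.Positive) {L : ℕ} {σ : ℝ} (hσ : 1 ≤ σ)
    (hσ' : σ ≤ 5 / 4) (hH' : G.IsHopsetUpTo H' β (σ - 1) L) {S : Set ℝ≥0∞} (hS : Known H' S)
    (m : ℕ) :
    wp G K (scale K E k ((n : ℝ≥0∞) ^ 3 * G.maxLen) b H') S m fun H S' m' =>
      G.IsHopsetUpTo H β (σ * (1 + ε) - 1) (τ * L) ∧ Known H S' ∧ H.size ≤ 32 * (n * b 0) ∧
        m' = m + (k + 1) * E := by
  refine wp_bind (wp_mono (wp_iter (I := fun i p S' m' =>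
    Inv G H' (τ * L) σ δ b i p S' ∧ m' = m + i * E) (k + 1) ?_ ?_) ?_)
  · refine ⟨⟨hS, known_empty S, fun u v => le_top, fun _ => rfl, fun j hj => by omega, by simp, ?_⟩,
      by simp⟩
    simp [size_empty]
  · rintro i hi p S₁ m₁ ⟨h, rfl⟩
    refine wp_mono (hp.wp_level hG hσ hσ' hH' hi h _) ?_
    rintro p' S' m' ⟨h', rfl⟩
    exact ⟨h', by ring⟩
  · rintro p S₁ m₁ ⟨h, rfl⟩
    have hA : p.2 = ∅ := by
      by_contra hne
      have h1 : 1 ≤ p.2.card := Finset.card_pos.2 (Finset.nonempty_iff_ne_empty.2 hne)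
      have h2 := Nat.mul_le_mul_right (∏ j ∈ Finset.range (k + 1), 2 * b j) h1
      have h3 := h.card_le
      have h4 := hp.lt_prod
      omega
    have hap := h.approx k rfl
    rw [hA, Finset.coe_empty, ← hp.β_eq] at hap
    have hδ := hp.δ_pos
    refine ⟨hap.isHopsetUpTo (by positivity) ?_ h.dist_le, h.known,
      (Nat.le_add_right _ _).trans h.size_le, rfl⟩
    rw [add_sub_cancel]
    gcongr
    exact hp.δ_le

theorem one_le_β : 1 ≤ β := by
  rw [hp.β_eq]
  exact Nat.le_floor (by simpa using one_le_pow₀ hp.one_le_div)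

theorem maxList_ok (G : WGraph (Fin n)) (v : Fin n) : ListOk G K ∅ v (maxList v (G.len v)) := by
  constructor
  · refine (Finset.card_le_card (t := {v}) fun w hw => ?_).trans (by simpa using hp.one_le_K)
    rw [mem_supp, maxList] at hw
    by_contra h
    exact hw (if_neg fun h' => h (by simp [h']))
  · intro w
    unfold maxList
    split_ifs
    swap
    · exact .inl rfl
    right
    have hn : (1 : ℝ≥0∞) ≤ (n : ℝ≥0∞) ^ 3 := by
      have : 1 ≤ n ^ 3 := Nat.one_le_pow _ _ (by have := hp.two_le_n; omega)
      exact_mod_cast this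
    constructor
    · calc _ ≤ 1 * G.maxLen := by
            rw [one_mul]
            exact iSup_le fun u => iSup_le fun h => G.len_le_maxLen h
        _ ≤ _ := by gcongr
    · refine SumOf.mono (c := 1) ?_ (by norm_num)
      have : Nonempty (Fin n) := ⟨v⟩
      obtain ⟨u, hu⟩ := exists_eq_ciSup_of_finite
        (f := fun u => ⨆ (_ : G.len v u ≠ ⊤), G.len v u)
      rw [← hu]
      by_cases h : G.len v u = ⊤
      · simp only [h, ne_eq, not_true_eq_false, iSup_false, bot_eq_zero]
        exact sumOf_zero _ _ _ _
      · simp only [ne_eq, h, not_false_eq_true, iSup_true]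
        exact sumOf_of_mem (.inr ⟨u, rfl⟩)

theorem wp_hopsetProg {G : WGraph (Fin n)} (hG : G.Positive) {ε' : ℝ}
    (hε : (1 + ε) ^ s ≤ 1 + ε') :
    wp G K (hopsetProg n K E k s b) ∅ 0 fun H _ m => m ≤ 1 + s * ((k + 1) * E) ∧
      G.IsHopset H β ε' ∧ H.size ≤ 32 * (n * b 0) := by
  refine wp_bind ⟨hp.maxList_ok G, ?_⟩
  -- The initial broadcast tells all vertices the largest weight, so they use the same cutoff.
  have hM : (⨆ v, maxList v (G.len v) v) = G.maxLen := by simp [maxList, maxLen]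
  change wp G K (iter (fun _ H' => scale K E k ((n : ℝ≥0∞) ^ 3 * ⨆ v, maxList v (G.len v) v) b H')
    s ∅) _ _ _
  rw [hM]
  refine wp_mono (wp_iter (I := fun ℓ H S' m' =>
    G.IsHopsetUpTo H β ((1 + ε) ^ ℓ - 1) (τ ^ ℓ) ∧ Known H S' ∧ H.size ≤ 32 * (n * b 0) ∧
      m' = 1 + ℓ * ((k + 1) * E)) s ?_ ?_) ?_
  · refine ⟨by simpa using G.isHopsetUpTo_empty hp.one_le_β, known_empty _, ?_, by simp⟩
    rw [size_empty]; exact Nat.zero_le _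
  · rintro ℓ hℓ H S m ⟨h, hk, -, rfl⟩
    have hε0 := hp.ε_pos
    have h1 : ((1 : ℝ) + ε) ^ ℓ ≤ 5 / 4 := by
      refine one_add_pow_le hε0.le (le_trans ?_ hp.mul_ε_le)
      gcongr
    refine wp_mono (hp.wp_scale hG (one_le_pow₀ (by linarith)) h1 h hk _) ?_
    rintro H₁ S₁ m₁ ⟨h2, h3, h4, rfl⟩
    exact ⟨by rw [pow_succ, pow_succ']; exact h2, h3, h4, by ring⟩
  · rintro H S m ⟨h, -, hs, rfl⟩
    refine ⟨le_rfl, ?_, hs⟩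
    have h1 := h.isHopset (by simpa using hp.le_pow)
    refine ⟨h1.1, fun u v => ⟨(h1.2 u v).1, (h1.2 u v).2.trans ?_⟩⟩
    gcongr
    linarith

end Params

end BProg

/-! ### Sampling rates and the choice of parameters. -/

namespace BProg

open WGraph

/-- The inverse sampling rates. -/
noncomputable def rate (n k : ℕ) (ρ : ℝ) (i : ℕ) : ℕ :=
  min (⌈(n : ℝ) ^ (1 / ((2 : ℝ) ^ k - 1))⌉₊ ^ 2 ^ i) ⌈(n : ℝ) ^ ρ⌉₊

section Rate

variable {n k : ℕ} {ρ : ℝ}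

theorem one_le_rate (hn : 2 ≤ n) (i : ℕ) : 1 ≤ rate n k ρ i := by
  have hn' : (0 : ℝ) < n := by exact_mod_cast (by omega : 0 < n)
  exact le_min (Nat.one_le_pow _ _ (Nat.ceil_pos.2 (by positivity))) (Nat.ceil_pos.2 (by positivity))

theorem rate_succ_le (hn : 2 ≤ n) (i : ℕ) : rate n k ρ (i + 1) ≤ rate n k ρ i ^ 2 := by
  have hn' : (0 : ℝ) < n := by exact_mod_cast (by omega : 0 < n)
  have hB : 1 ≤ ⌈(n : ℝ) ^ ρ⌉₊ := Nat.ceil_pos.2 (by positivity)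
  unfold rate
  rcases min_choice (⌈(n : ℝ) ^ (1 / ((2 : ℝ) ^ k - 1))⌉₊ ^ 2 ^ i) ⌈(n : ℝ) ^ ρ⌉₊ with h | h <;> rw [h]
  · rw [← pow_mul, ← pow_succ]
    exact min_le_left _ _
  · refine (min_le_right _ _).trans ?_
    nlinarith

/-- For `i ≥ k` the uncapped rate is at least `n ^ (2 ^ i / (2 ^ k - 1)) ≥ n`, so the cap `n ^ ρ`
has been reached. -/
theorem le_rate (hn : 2 ≤ n) (hk : 2 ≤ k) (hρ : ρ < 1) {i : ℕ} (hi : k ≤ i) :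
    (n : ℝ) ^ ρ ≤ rate n k ρ i := by
  have hn' : (1 : ℝ) ≤ n := by exact_mod_cast (by omega : 1 ≤ n)
  have h2 : (1 : ℝ) < 2 ^ k := one_lt_pow₀ (by norm_num) (by omega)
  have hν : 0 < 1 / ((2 : ℝ) ^ k - 1) := by
    have : 0 < (2 : ℝ) ^ k - 1 := by linarith
    positivity
  unfold rate
  rw [Nat.cast_min]
  refine le_min ?_ (Nat.le_ceil _)
  push_cast
  calc (n : ℝ) ^ ρ ≤ (n : ℝ) ^ (1 / ((2 : ℝ) ^ k - 1) * (2 ^ i : ℕ)) := by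
        refine Real.rpow_le_rpow_of_exponent_le hn' (hρ.le.trans ?_)
        rw [one_div_mul_eq_div, le_div_iff₀ (by linarith)]
        have : (2 : ℝ) ^ k ≤ 2 ^ i := pow_le_pow_right₀ (by norm_num) hi
        push_cast
        linarith
    _ = ((n : ℝ) ^ (1 / ((2 : ℝ) ^ k - 1))) ^ 2 ^ i := by
        rw [Real.rpow_mul (by linarith), Real.rpow_natCast]
    _ ≤ _ := by gcongr; exact Nat.le_ceil _

/-- The last `⌊1 / ρ⌋ + 1` factors are at least `2 n ^ ρ` each and already exceed `n`, since `ρ (⌊1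
/ ρ⌋ + 1) ≥ 1`. -/
theorem lt_prod_rate (hn : 2 ≤ n) (hk : 2 ≤ k) (hρ0 : 0 < ρ) (hρ : ρ < 1) :
    n < ∏ i ∈ Finset.range (k + ⌊1 / ρ⌋₊ + 1), 2 * rate n k ρ i := by
  have hn' : (1 : ℝ) ≤ n := by exact_mod_cast (by omega : 1 ≤ n)
  rw [add_assoc, Finset.prod_range_add]
  have h1 : 1 ≤ ∏ i ∈ Finset.range k, 2 * rate n k ρ i :=
    Finset.one_le_prod' fun i _ => by have := one_le_rate (k := k) (ρ := ρ) hn i; omega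
  have h2 : (n : ℝ) < ∏ j ∈ Finset.range (⌊1 / ρ⌋₊ + 1), 2 * (rate n k ρ (k + j) : ℝ) := by
    calc (n : ℝ) < 2 * n := by linarith
      _ ≤ 2 * (n : ℝ) ^ (ρ * (⌊1 / ρ⌋₊ + 1 : ℕ)) := by
          gcongr
          refine Real.self_le_rpow_of_one_le hn' ?_
          have := (Nat.lt_floor_add_one (1 / ρ)).le
          rw [div_le_iff₀ hρ0] at this
          push_cast
          linarith
      _ = 2 * ((n : ℝ) ^ ρ) ^ (⌊1 / ρ⌋₊ + 1) := by rw [Real.rpow_mul (by linarith), Real.rpow_natCast]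
      _ ≤ 2 ^ (⌊1 / ρ⌋₊ + 1) * ((n : ℝ) ^ ρ) ^ (⌊1 / ρ⌋₊ + 1) := by
          gcongr
          exact le_self_pow₀ (by norm_num) (by omega)
      _ = ∏ j ∈ Finset.range (⌊1 / ρ⌋₊ + 1), 2 * (n : ℝ) ^ ρ := by
          rw [Finset.prod_const, Finset.card_range, mul_pow]
      _ ≤ _ := by
          refine Finset.prod_le_prod (fun _ _ => by positivity) fun j _ => ?_
          gcongr
          exact le_rate hn hk hρ (by omega)
  have h3 : n < ∏ j ∈ Finset.range (⌊1 / ρ⌋₊ + 1), 2 * rate n k ρ (k + j) := by exact_mod_cast h2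
  exact h3.trans_le (Nat.le_mul_of_pos_left _ h1)

end Rate

theorem one_le_logb {n : ℕ} (hn : 2 ≤ n) : 1 ≤ Real.logb 2 n := by
  have hn' : (2 : ℝ) ≤ n := by exact_mod_cast hn
  rw [Real.le_logb_iff_rpow_le (by norm_num) (by linarith)]; simpa using hn'

theorem two_rpow_logb {n : ℕ} (hn : 2 ≤ n) : (2 : ℝ) ^ Real.logb 2 n = n :=
  Real.rpow_logb (by norm_num) (by norm_num) (by exact_mod_cast (by omega : 0 < n))

theorem clog_le {n : ℕ} (hn : 2 ≤ n) : (Nat.clog 2 n : ℝ) ≤ Real.logb 2 n + 1 := by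
  have h := Nat.pow_pred_clog_lt_self (b := 2) (by norm_num) (x := n) (by omega)
  have h1 : ((Nat.clog 2 n).pred : ℝ) ≤ Real.logb 2 n := by
    rw [Real.le_logb_iff_rpow_le (by norm_num) (by exact_mod_cast (by omega : 0 < n)),
      Real.rpow_natCast]
    exact_mod_cast h.le
  have h2 : Nat.clog 2 n ≤ (Nat.clog 2 n).pred + 1 := by
    rw [Nat.pred_eq_sub_one]; omega
  have h3 : (Nat.clog 2 n : ℝ) ≤ ((Nat.clog 2 n).pred : ℝ) + 1 := by exact_mod_cast h2
  linarith

/-- The power is at most `exp (ε / 2) ≤ 1 / (1 - ε / 2) ≤ 1 + ε`; the last inequality needs `ε ≤ 1`.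
-/
theorem one_add_div_pow_le {ε : ℝ} (hε : 0 < ε) (hε' : ε < 1 / 5) {s : ℕ} (hs : 1 ≤ s) :
    (1 + ε / (2 * s)) ^ s ≤ 1 + ε := by
  have hs' : (1 : ℝ) ≤ s := by exact_mod_cast hs
  have h1 : (1 + ε / (2 * s)) ^ s ≤ Real.exp (ε / 2) := by
    calc (1 + ε / (2 * s)) ^ s ≤ Real.exp (ε / (2 * s)) ^ s := by
          gcongr; linarith [Real.add_one_le_exp (ε / (2 * s))]
      _ = _ := by rw [← Real.exp_nat_mul]; congr 1; field_simp
  have h2 : 1 - ε / 2 ≤ Real.exp (-(ε / 2)) := by linarith [Real.add_one_le_exp (-(ε / 2))]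
  have h3 : Real.exp (ε / 2) * Real.exp (-(ε / 2)) = 1 := by rw [← Real.exp_add]; simp
  have h4 := Real.exp_pos (ε / 2)
  refine h1.trans ?_
  by_contra hlt
  nlinarith

/-- With hop scales `2 ^ (t * j)`. -/
theorem exists_hopset_alg {n k t : ℕ} {ρ ε q : ℝ} (hn : 2 ≤ n) (hk : 2 ≤ k) (hρ0 : 0 < ρ)
    (hρ1 : ρ < 1) (hε0 : 0 < ε) (hε1 : ε < 1 / 5) (hq : 0 ≤ q) (ht : 1 ≤ t)
    (htn : (t : ℝ) ≤ Real.logb 2 n) :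
    ∃ (β T : ℕ) (A : CliqueAlg n 3),
      (β : ℝ) ≤ (180 * ((k + 1 / ρ) * Real.logb 2 n / (t * ε))) ^ (k + 1 / ρ) ∧
      (T : ℝ) ≤ 640 * Real.logb 2 n ^ 3 * ((n : ℝ) ^ ρ * β * (2 ^ t / t)) ∧
      A.ComputesHopset T β ε (64 * (n : ℝ) ^ (1 + 1 / ((2 : ℝ) ^ k - 1))) q := by
  have hn1 : (1 : ℝ) ≤ n := by exact_mod_cast (by omega : 1 ≤ n)
  have ht1 : (1 : ℝ) ≤ t := by exact_mod_cast ht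
  have hk2 : (2 : ℝ) ≤ k := by exact_mod_cast hk
  have hlog := one_le_logb hn
  have hρi : 1 < 1 / ρ := by rw [lt_div_iff₀ hρ0]; linarith
  set l := Real.logb 2 n with hl
  have hX : 1 ≤ (k + 1 / ρ) * l / (t * ε) := by
    rw [le_div_iff₀ (by positivity)]
    nlinarith
  -- If `n = 2 ^ l` is below `2 ^ (k + 1 / ρ)`, then `β = n` is allowed and the empty hopset works
  -- without any communication.
  by_cases hbig : l < k + 1 / ρ
  · refine ⟨n, 1 * 0, toAlg (by omega) 1 (pure ∅), ?_, ?_, computesHopset (by omega) le_rfl _ hq ?_⟩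
    · calc (n : ℝ) = 2 ^ l := (two_rpow_logb hn).symm
        _ ≤ 2 ^ (k + 1 / ρ) := Real.rpow_le_rpow_of_exponent_le (by norm_num) hbig.le
        _ ≤ _ := Real.rpow_le_rpow (by norm_num) (by linarith) (by positivity)
    · simp only [mul_zero, Nat.cast_zero]
      positivity
    · intro G hG
      refine ⟨le_rfl, ⟨fun u v => le_top, fun u v => ?_⟩, ?_⟩
      · have h : ∀ u v, (G ∪ ∅).len u v = G.len u v := fun u v => by
          rw [union_len, empty_len, min_eq_left le_top]
        have h1 := hopDist_mono_len (fun u v => (h u v).le) n u v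
        have h2 := hopDist_mono_len (fun u v => (h u v).ge) n u v
        have h3 := G.dist_eq_hopDist (t := n) (by simp) u v
        rw [le_antisymm h1 h2, ← h3]
        refine ⟨le_rfl, le_mul_of_one_le_left zero_le ?_⟩
        rw [ENNReal.one_le_ofReal]
        linarith
      · rw [size_empty, Nat.cast_zero]
        positivity
  · rw [not_lt] at hbig
    set k' := k + ⌊1 / ρ⌋₊ with hk'
    have hk'0 : 2 ≤ k' := by omega
    have hk'r : (k' : ℝ) ≤ k + 1 / ρ := by
      rw [hk']; push_cast
      have := Nat.floor_le (by positivity : 0 ≤ 1 / ρ)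
      linarith
    have hk'2 : (2 : ℝ) ≤ k' := by exact_mod_cast hk'0
    -- This many scales of ratio `2 ^ t` cover paths of `n` edges. Each gets the error `ε / (2 s)`.
    set s := ⌈l / t⌉₊ with hs
    have hlt : 1 ≤ l / t := by rw [le_div_iff₀ (by linarith)]; linarith
    have hs1 : 1 ≤ s := Nat.ceil_pos.2 (by linarith)
    have hs1' : (1 : ℝ) ≤ s := by exact_mod_cast hs1
    have hs2 : (s : ℝ) ≤ 2 * (l / t) := by
      have := Nat.ceil_lt_add_one (by linarith : 0 ≤ l / t)
      linarith
    set ε₀ := ε / (2 * s) with hε₀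
    have hε₀0 : 0 < ε₀ := by positivity
    have hsε : s * ε₀ = ε / 2 := by rw [hε₀]; field_simp
    have hε₀1 : ε₀ < 1 := by nlinarith
    set δ := ε₀ / (15 * k') with hδ
    have hδ0 : 0 < δ := by positivity
    have h3δ : 3 / δ = 90 * (k' * s) / ε := by rw [hδ, hε₀]; field_simp; norm_num
    set β := ⌊(3 / δ) ^ k'⌋₊ with hβ
    set B := ⌈(n : ℝ) ^ ρ⌉₊ with hB
    set K := 4 * B * (Nat.clog 2 n + 3) with hK
    set E := 2 * (2 ^ t * β) with hE
    have hpar : Params n K E k' s (2 ^ t) β (rate n k ρ) ε₀ δ :=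
      { two_le_n := hn
        two_le_k := hk'0
        two_le_τ := Nat.le_self_pow (by omega) 2
        ε_pos := hε₀0
        mul_ε_le := by linarith
        δ_pos := hδ0
        δ_lt := by rw [hδ]; gcongr
        δ_le := by
          have : δ * (15 * k') = ε₀ := by rw [hδ]; field_simp
          nlinarith
        β_eq := rfl
        E_eq := rfl
        one_le_b := one_le_rate hn
        b_succ_le := rate_succ_le hn
        le_K := fun i => by
          rw [hK]
          gcongr
          exact min_le_right _ _
        lt_prod := lt_prod_rate hn hk hρ0 hρ1
        le_pow := by
          have h1 : (n : ℝ) ≤ 2 ^ ((t * s : ℕ) : ℝ) := by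
            rw [← two_rpow_logb hn]
            refine Real.rpow_le_rpow_of_exponent_le (by norm_num) ?_
            have := Nat.le_ceil (l / t)
            rw [div_le_iff₀ (by linarith)] at this
            push_cast
            rw [mul_comm]
            exact this
          rw [Real.rpow_natCast] at h1
          rw [← pow_mul]
          exact_mod_cast h1 }
    refine ⟨β, K * (1 + s * ((k' + 1) * E)), toAlg (by omega) K (hopsetProg n K E k' s (rate n k ρ)),
      ?_, ?_, computesHopset (by omega) hpar.one_le_K _ hq fun G hG =>
        wp_mono (hpar.wp_hopsetProg hG (one_add_div_pow_le hε0 hε1 hs1)) ?_⟩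
    · have h1 : 3 / δ ≤ 180 * ((k + 1 / ρ) * l / (t * ε)) := by
        rw [h3δ]
        calc 90 * (k' * s) / ε ≤ 90 * ((k + 1 / ρ) * (2 * (l / t))) / ε := by gcongr
          _ = _ := by field_simp; norm_num
      calc (β : ℝ) ≤ (3 / δ) ^ k' := Nat.floor_le (by positivity)
        _ ≤ (180 * ((k + 1 / ρ) * l / (t * ε))) ^ k' := by gcongr
        _ = (180 * ((k + 1 / ρ) * l / (t * ε))) ^ (k' : ℝ) := (Real.rpow_natCast _ _).symm
        _ ≤ _ := Real.rpow_le_rpow_of_exponent_le (by linarith) hk'r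
    · have hβ1 : (1 : ℝ) ≤ β := by exact_mod_cast hpar.one_le_β
      have hp1 : (1 : ℝ) ≤ (n : ℝ) ^ ρ := Real.one_le_rpow hn1 hρ0.le
      have hB2 : (B : ℝ) ≤ 2 * (n : ℝ) ^ ρ := by
        have := Nat.ceil_lt_add_one (by positivity : 0 ≤ (n : ℝ) ^ ρ)
        linarith
      have hc := clog_le hn
      have h2t : (1 : ℝ) ≤ 2 ^ t := one_le_pow₀ (by norm_num)
      have hK2 : (K : ℝ) ≤ 40 * (n : ℝ) ^ ρ * l := by
        rw [hK]; push_cast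
        calc 4 * (B : ℝ) * (Nat.clog 2 n + 3) ≤ 4 * (2 * (n : ℝ) ^ ρ) * (5 * l) := by
              gcongr; linarith
          _ = _ := by ring
      have hEr : (E : ℝ) = 2 * (2 ^ t * β) := by rw [hE]; push_cast; ring
      -- In this case `k' ≤ l`, so the number of vertex sets disappears in a logarithmic factor.
      have hkl : (k' : ℝ) + 1 ≤ 2 * l := by linarith
      have h1 : (1 : ℝ) ≤ s * ((k' + 1) * E) := by
        rw [hEr]
        have h3 : (1 : ℝ) ≤ 2 ^ t * β := one_le_mul_of_one_le_of_one_le h2t hβ1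
        exact one_le_mul_of_one_le_of_one_le hs1'
          (one_le_mul_of_one_le_of_one_le (by linarith) (by linarith))
      push_cast
      calc (K : ℝ) * (1 + s * ((k' + 1) * E)) ≤ K * (2 * (s * ((k' + 1) * E))) := by
            gcongr; linarith
        _ ≤ (40 * (n : ℝ) ^ ρ * l) * (2 * (2 * (l / t) * (2 * l * (2 * (2 ^ t * β))))) := by
            rw [hEr]; gcongr
        _ = 640 * l ^ 3 * ((n : ℝ) ^ ρ * β * (2 ^ t / t)) := by field_simp; norm_num
    · rintro H S m ⟨hm, hH, hsize⟩
      refine ⟨hm, hH, ?_⟩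
      have h1 : (1 : ℝ) < 2 ^ k := one_lt_pow₀ (by norm_num) (by omega)
      have hν : 0 ≤ 1 / ((2 : ℝ) ^ k - 1) := by
        have : 0 < (2 : ℝ) ^ k - 1 := by linarith
        positivity
      set ν := 1 / ((2 : ℝ) ^ k - 1) with hν'
      have hp : 1 ≤ (n : ℝ) ^ ν := Real.one_le_rpow hn1 hν
      have hr : (rate n k ρ 0 : ℝ) ≤ 2 * (n : ℝ) ^ ν := by
        have h2 : rate n k ρ 0 ≤ ⌈(n : ℝ) ^ ν⌉₊ := by
          refine (min_le_left _ _).trans ?_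
          simp [hν']
        have h3 : (rate n k ρ 0 : ℝ) ≤ ⌈(n : ℝ) ^ ν⌉₊ := by exact_mod_cast h2
        have := Nat.ceil_lt_add_one (by positivity : 0 ≤ (n : ℝ) ^ ν)
        linarith
      calc (H.size : ℝ) ≤ 32 * (n * rate n k ρ 0) := by exact_mod_cast hsize
        _ ≤ 32 * (n * (2 * (n : ℝ) ^ ν)) := by gcongr
        _ = 64 * (n : ℝ) ^ (1 + ν) := by
            rw [Real.rpow_add (by linarith), Real.rpow_one]; ring

end BProg

/-! ### The main theorem. -/

theorem CliqueAlg.ComputesHopset.mono_size {n c : ℕ} {A : CliqueAlg n c} {T β : ℕ} {ε S S' q : ℝ}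
    (h : A.ComputesHopset T β ε S q) (hS : S ≤ S') : A.ComputesHopset T β ε S' q :=
  ⟨h.1, fun G hG => ⟨fun ω => ((h.2 G hG).1 ω).imp (fun ⟨H, h1, h2, h3⟩ => ⟨H, h1, h2, h3.trans hS⟩)
    id, (h.2 G hG).2⟩⟩

theorem mainTheorem6 :
    -- the stretch lemma for one hop scale
    (∀ (n : ℕ), 2 ≤ n → ∀ (G H' : WGraph (Fin n)), G.Positive →
      ∀ (k' ℓ : ℕ) (ε δ : ℝ) (A : ℕ → Set (Fin n)) (p : ℕ → Fin n → Fin n) (β : ℕ),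
      2 ≤ k' → 1 ≤ ℓ → ℓ ≤ Nat.clog 2 n → 0 < ε → ε < 1 / (5 * Real.logb 2 n) →
      0 < δ → δ < 1 / (15 * k') → β = ⌊(3 / δ) ^ k'⌋₊ →
      G.IsHopsetUpTo H' β ((1 + ε) ^ (ℓ - 1) - 1) (2 ^ (ℓ - 1)) →
      WGraph.IsHierarchy A k' → G.ArePivots H' A p β →
      ∀ x y : Fin n, G.dist x y = G.hopDist (2 ^ ℓ) x y → ∀ i ≤ k',
        (G ∪ G.partialHopset H' A p β (i + 1)).hopDist ⌊(3 / δ) ^ i⌋₊ x y ≤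
            ENNReal.ofReal ((1 + ε) ^ (ℓ - 1) * (1 + 12 * δ * i)) * G.dist x y ∨
          ∃ z ∈ A (i + 1),
            (G ∪ G.partialHopset H' A p β (i + 1)).hopDist ⌊(3 / δ) ^ i⌋₊ x z ≤
              3 * G.dist x y) ∧
    -- the construction over the hop scales `2 ^ ℓ`
    (∀ (n : ℕ), 2 ≤ n → ∀ (G : WGraph (Fin n)), G.Positive →
      ∀ (k' : ℕ) (ε : ℝ) (β : ℕ) (H : ℕ → WGraph (Fin n)),
      2 ≤ k' → 0 < ε → ε < 1 / (5 * Real.logb 2 n) → β = ⌊(45 * k' / ε) ^ k'⌋₊ →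
      H 0 = ∅ → (∀ ℓ < Nat.clog 2 n, G.IsNextScale (H ℓ) (H (ℓ + 1)) k' β) →
      (∀ ℓ ≤ Nat.clog 2 n, G.IsHopsetUpTo (H ℓ) β ((1 + ε) ^ ℓ - 1) (2 ^ ℓ)) ∧
        G.IsHopset (H (Nat.clog 2 n)) β ((1 + ε) ^ Nat.clog 2 n - 1)) ∧
    -- the distributed algorithms
    ∃ c C : ℕ, ∀ γ : ℕ, ∃ D : ℕ, ∀ (n k : ℕ) (ρ ε : ℝ),
      2 ≤ n → 2 ≤ k → 0 < ρ → ρ < 1 → 0 < ε → ε < 1 / 5 →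
      (∃ (β T : ℕ) (A : CliqueAlg n c),
        (β : ℝ) ≤ (C * ((k + 1 / ρ) * Real.logb 2 n / ε)) ^ (k + 1 / ρ + 1) ∧
        (T : ℝ) ≤ D * Real.logb 2 n ^ D * ((n : ℝ) ^ ρ * β) ∧
        A.ComputesHopset T β ε (C * (n : ℝ) ^ (1 + 1 / ((2 : ℝ) ^ k - 1))) (1 / (n : ℝ) ^ γ)) ∧
      (∀ t : ℕ, 1 ≤ t → (t : ℝ) ≤ Real.logb 2 n →
        ∃ (β T : ℕ) (A : CliqueAlg n c),
          (β : ℝ) ≤ (C * ((k + 1 / ρ) * Real.logb 2 n / (t * ε))) ^ (k + 1 / ρ) ∧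
          (T : ℝ) ≤ D * Real.logb 2 n ^ D * ((n : ℝ) ^ ρ * β * (2 ^ t / t)) ∧
          A.ComputesHopset T β ε (C * (n : ℝ) ^ (1 + 1 / ((2 : ℝ) ^ k - 1))) (1 / (n : ℝ) ^ γ)) ∧
      (ρ < 1 / 2 →
        ∃ (β T : ℕ) (A : CliqueAlg n c),
          (β : ℝ) ≤ (C * ((k + 1 / ρ) / (ρ * ε))) ^ (k + 2 / ρ) ∧
          (T : ℝ) ≤ D * Real.logb 2 n ^ D * ((n : ℝ) ^ ρ * β) ∧
          A.ComputesHopset T β ε (C * (n : ℝ) ^ (1 + 1 / ((2 : ℝ) ^ k - 1))) (1 / (n : ℝ) ^ γ)) := by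
  -- `3` is the message constant of `toAlg`. `1440 = 180 * 2 * 4` is needed for the last bound, with
  -- `k + 2 / ρ ≤ 2 (k + 1 / ρ)` and `log n / t ≤ 4 / ρ`; `1280 = 640 * 2` absorbs a factor `2` in
  -- the rounds and exceeds the exponent `3`.
  refine ⟨WGraph.stretch_partialHopset, WGraph.isHopset_iterate, 3, 1440, fun γ => ⟨1280, ?_⟩⟩
  intro n k ρ ε hn hk hρ0 hρ1 hε0 hε1
  have hn1 : (1 : ℝ) ≤ n := by exact_mod_cast (by omega : 1 ≤ n)
  have hk2 : (2 : ℝ) ≤ k := by exact_mod_cast hk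
  have hlog := BProg.one_le_logb hn
  have hρi : 1 < 1 / ρ := by rw [lt_div_iff₀ hρ0]; linarith
  have hq : (0 : ℝ) ≤ 1 / (n : ℝ) ^ γ := by positivity
  have hS : 64 * (n : ℝ) ^ (1 + 1 / ((2 : ℝ) ^ k - 1)) ≤
      ((1440 : ℕ) : ℝ) * (n : ℝ) ^ (1 + 1 / ((2 : ℝ) ^ k - 1)) := by
    push_cast; gcongr; norm_num
  have hpoly : Real.logb 2 n ^ 3 ≤ Real.logb 2 n ^ 1280 := pow_le_pow_right₀ hlog (by norm_num)
  refine ⟨?_, fun t ht htn => ?_, fun _ => ?_⟩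
  · obtain ⟨β, T, A, hβ, hT, hA⟩ := BProg.exists_hopset_alg hn hk hρ0 hρ1 hε0 hε1 hq le_rfl
      (by simpa using hlog)
    refine ⟨β, T, A, hβ.trans ?_, hT.trans ?_, hA.mono_size hS⟩
    · have hX : 1 ≤ (k + 1 / ρ) * Real.logb 2 n / ε := by
        rw [le_div_iff₀ hε0]; nlinarith
      rw [Nat.cast_one, one_mul]
      push_cast
      exact (Real.rpow_le_rpow (by positivity) (by gcongr; norm_num) (by positivity)).trans
        (Real.rpow_le_rpow_of_exponent_le (by linarith) (by linarith))
    · push_cast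
      calc _ = 1280 * Real.logb 2 n ^ 3 * ((n : ℝ) ^ ρ * β) := by ring
        _ ≤ _ := by gcongr
  · obtain ⟨β, T, A, hβ, hT, hA⟩ := BProg.exists_hopset_alg hn hk hρ0 hρ1 hε0 hε1 hq ht htn
    refine ⟨β, T, A, hβ.trans ?_, hT.trans ?_, hA.mono_size hS⟩
    · push_cast
      exact Real.rpow_le_rpow (by positivity) (by gcongr; norm_num) (by positivity)
    · push_cast
      gcongr
      norm_num
  · -- scales of about `n ^ (ρ / 2)` hops
    obtain ⟨t, ht, htn, htl, htp⟩ : ∃ t : ℕ, 1 ≤ t ∧ (t : ℝ) ≤ Real.logb 2 n ∧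
        Real.logb 2 n / t ≤ 4 / ρ ∧ (2 : ℝ) ^ t ≤ 2 * (n : ℝ) ^ (ρ / 2) := by
      by_cases hx : 1 ≤ ρ / 2 * Real.logb 2 n
      · have hf := Nat.floor_le (by linarith : 0 ≤ ρ / 2 * Real.logb 2 n)
        have hf1 : 1 ≤ ⌊ρ / 2 * Real.logb 2 n⌋₊ := Nat.le_floor (by simpa using hx)
        have hf1' : (1 : ℝ) ≤ ⌊ρ / 2 * Real.logb 2 n⌋₊ := by exact_mod_cast hf1
        have hf2 := Nat.lt_floor_add_one (ρ / 2 * Real.logb 2 n)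
        refine ⟨⌊ρ / 2 * Real.logb 2 n⌋₊, hf1, hf.trans (by nlinarith), ?_, ?_⟩
        · rw [div_le_div_iff₀ (by linarith) hρ0]
          nlinarith
        · calc (2 : ℝ) ^ ⌊ρ / 2 * Real.logb 2 n⌋₊
              = 2 ^ ((⌊ρ / 2 * Real.logb 2 n⌋₊ : ℕ) : ℝ) := (Real.rpow_natCast _ _).symm
            _ ≤ 2 ^ (Real.logb 2 n * (ρ / 2)) :=
                Real.rpow_le_rpow_of_exponent_le (by norm_num) (by linarith)
            _ = (n : ℝ) ^ (ρ / 2) := by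
                rw [Real.rpow_mul (by norm_num), BProg.two_rpow_logb hn]
            _ ≤ _ := le_mul_of_one_le_left (by positivity) (by norm_num)
      -- Here `log n < 2 / ρ`, so even the ratio `2` gives few scales.
      · refine ⟨1, le_rfl, by simpa using hlog, ?_, ?_⟩
        · rw [Nat.cast_one, div_one, le_div_iff₀ hρ0]
          linarith
        · have := Real.one_le_rpow hn1 (by positivity : 0 ≤ ρ / 2)
          linarith
    have ht1 : (1 : ℝ) ≤ t := by exact_mod_cast ht
    have he : 1 / (ρ / 2) = 2 / ρ := by rw [one_div_div]
    -- The sampling parameter is halved: one factor `n ^ (ρ / 2)` goes to the lists and one to `2 ^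
    -- t`. This turns `1 / ρ` into `2 / ρ` in the exponent.
    obtain ⟨β, T, A, hβ, hT, hA⟩ := BProg.exists_hopset_alg hn hk (half_pos hρ0) (by linarith) hε0
      hε1 hq ht htn
    rw [he] at hβ
    refine ⟨β, T, A, hβ.trans ?_, hT.trans ?_, hA.mono_size hS⟩
    · refine Real.rpow_le_rpow (by positivity) ?_ (by positivity)
      have h2 : 2 / ρ = 2 * (1 / ρ) := by ring
      calc 180 * ((k + 2 / ρ) * Real.logb 2 n / (t * ε))
          = 180 * ((k + 2 / ρ) * (Real.logb 2 n / t) / ε) := by field_simp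
        _ ≤ 180 * ((2 * (k + 1 / ρ)) * (4 / ρ) / ε) := by gcongr; linarith
        _ = ((1440 : ℕ) : ℝ) * ((k + 1 / ρ) / (ρ * ε)) := by push_cast; field_simp; norm_num
    · have h1 : (2 : ℝ) ^ t / t ≤ 2 * (n : ℝ) ^ (ρ / 2) := (div_le_self (by positivity) ht1).trans htp
      have h2 : (n : ℝ) ^ (ρ / 2) * (n : ℝ) ^ (ρ / 2) = (n : ℝ) ^ ρ := by
        rw [← Real.rpow_add (by linarith)]; congr 1; ring
      calc _ ≤ 640 * Real.logb 2 n ^ 3 * ((n : ℝ) ^ (ρ / 2) * β * (2 * (n : ℝ) ^ (ρ / 2))) := by gcongr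
        _ = 1280 * Real.logb 2 n ^ 3 * ((n : ℝ) ^ ρ * β) := by rw [← h2]; ring
        _ ≤ _ := by push_cast; gcongr
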